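/- **Divergences.** Let $\mathcal F$ be the set of convex $f:(0,\infty)\to\mathbb R$ with $f(1)=0$. For discrete distributions $\mu_1,\mu_2$ on a set $A$ put $\Delta_f(\mu_1,\mu_2)=\sum_{a\in A}\mu_2(a)\,f(\mu_1(a)/\mu_2(a))\in(-\infty,\infty]$, with $f(0)=\lim_{t\to0+}f(t)$, $0f(0/0)=0$, $0f(p/0)=p\lim_{u\to\infty}f(u)/u$. For $f_1,f_2,f_3\in\mathcal F$, $(f_1,f_2)$ are *$f_3$-composable* if $\Delta_{f_3}(\mathsf{bind}\,\mu_1M_1,\mathsf{bind}\,\mu_2M_2)\le\Delta_{f_1}(\mu_1,\mu_2)+\sup_v\Delta_{f_2}(M_1v,M_2v)$ for all sets $A,B$, distributions $\mu_i$ on $A$ and maps $M_i$ from $A$ to distributions on $B$. The *$(f,\delta)$-lifting* of $\Psi\subseteq A\times B$ relates $\mu_1$ on $A$ and $\mu_2$ on $B$ if there are distributions $\mu_L,\mu_R$ on $A\times B$, both supported in $\Psi$, with $\pi_1\mu_L=\mu_1$, $\pi_2\mu_R=\mu_2$ and $\Delta_f(\mu_L,\mu_R)\le\delta$. **Language.**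 Consider the simply typed probabilistic language PrivInfer. Basic types $b$: unit, $\mathbb B$, $\mathbb N$, $\mathbb R$, positive reals $\mathbb R^+$, $\overline{\mathbb R}^+=[0,\infty]$, $[0,1]$, and lists. Simple types: $b$, symbolic distributions $\mathfrak D[b]$, $M[b]$ and $M[\mathfrak D[b]]$ (discrete distributions), and function types (all functions). Expressions: variables; constants (constructors of basic types, a given set of further constants with given meanings, the symbolic distributions $\mathsf{uniform},\mathsf{bernoulli},\mathsf{beta},\mathsf{normal}$, and the Laplace, Gaussian and exponential mechanisms); application, abstraction, case analysis, $\mathsf{letrec}$ (meaning the unique solution of its equation), $\mathsf{unit}$, $\mathsf{mlet}$ (bind), $\mathsf{observe}\,x\Rightarrow t\ \mathsf{in}\ u$ (Bayesian conditioning of the prior $u$ on the predicate $t$), $\mathsf{infer}:M[b]\to\mathfrak D[b]$ and $\mathsf{ran}:\mathfrak D[b]\to M[b]$ (the distribution that a symbolic distribution stands for). Continuous distributions are replaced by discrete versions of arbitrary fixed precision, further symbolic distributions may be given, the exponential mechanism selects from a given finite range of outputs, and the inference algorithm is any total exact one: $\mathsf{ran}(\mathsf{infer}\,\mu)=\mu$.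 **Relational types.** $T ::= b\mid\mathfrak D[b]\mid M_{f,\delta}\,T\mid\Pi(x::T).T\mid\{x::T\mid\varphi\}$, where the type below $M_{f,\delta}$ is a (refined) $b$ or $\mathfrak D[b]$, $f$ and $\delta$ are expressions of type $\mathbb R^+\to\mathbb R$ and $\overline{\mathbb R}^+$, and $\varphi$ is a first-order assertion over $\Delta_f(e,e')\le\delta$, $f\in\mathcal F$, $e=e'$, $e\le e'$ that may mention left and right instances $x_\triangleleft,x_\triangleright$ of the relational variables. Under a valuation $\theta$ a relational type denotes a set of pairs of values: all pairs for $b$ and $\mathfrak D[b]$; pairs of functions that map $T$-related to $U$-related values for $\Pi(x::T).U$; the pairs in $T$ that satisfy $\varphi$ for $\{x::T\mid\varphi\}$; the $(\llbracket f\rrbracket_\theta,\llbracket\delta\rrbracket_\theta)$-lifting of $\llbracket T\rrbracket_\theta$ for $M_{f,\delta}T$. Write $\theta\models\mathcal G$ if $\theta$ gives every $x::T$ in the relational environment $\mathcal G$ a pair of values in $\llbracket T\rrbracket_\theta$; "valid" means true under all $\theta\models\mathcal G$. **Typing.** $\mathcal G\vdash e_1\sim e_2::T$ ($e_1$ uses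 left, $e_2$ right instances; $\mathcal G\vdash e::T$ abbreviates $\mathcal G\vdash e\sim e::T$) is generated by the following rules, written with one expression for the two. - Variables have their declared type; a constant $c$ has each type $T$ with $(c,c)\in\llbracket T\rrbracket_\theta$ valid; abstraction and application are typed by $\Pi$-types, with substitution in the result type; $\mathsf{letrec}\,f\,x=e::\Pi(x::T).U$ if its equation validly has a unique solution on each side and $e::U$ in the environment $x::T$, $f::\Pi(y::\{y::T\mid\psi(y,x)\}).U$, for an assertion $\psi$ that is a well-founded order on pairs of arguments; case analysis, with the branches typed under the corresponding equations for the scrutinee, either on both sides in step (if the scrutinees validly have the same constructor) or on one side only. - Subsumption; adding a valid assertion as a refinement; replacing an expression by one that is validly equal to it. Subtyping is reflexive and transitive, contravariant/covariant for $\Pi$; $\{x::T\mid\varphi\}\preceq T$; $T\preceq\{x::U\mid\varphi\}$ if $T\preceq U$ and $\varphi$ is valid for $x::T$; $M_{f_1,\delta_1}T\preceq M_{f_2,\delta_2}U$ if $T\preceq U$, $f_1,f_2\in\mathcal F$ is valid, and, for all $\theta\models\mathcal G,x::T$, $f_2\le f_1$ pointwise and $\delta_1\le\delta_2<\infty$.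 - $\mathsf{unit}\,e::M_{f,\delta}T$ if $f\in\mathcal F$ is valid and $e::T$. - $\mathsf{mlet}\,x=e_1\,\mathsf{in}\,e_2::M_{f_3,\delta_1+\delta_2}T_2$ if $e_1::M_{f_1,\delta_1}T_1$, $(f_1,f_2)$ are validly $f_3$-composable, and $\mathcal G,x::T_1\vdash e_2::M_{f_2,\delta_2}T_2$, where $f_2,\delta_2,T_2$ do not mention $x$. - $\mathsf{infer}\,e::\{x::\mathfrak D[b]\mid\Delta_f(x_\triangleleft,x_\triangleright)\le\delta\}$ if $e::M_{f,\delta}\{x::b\mid x_\triangleleft=x_\triangleright\}$, and for $\mathsf{ran}$ conversely. - $\mathsf{observe}\,x\Rightarrow t\,\mathsf{in}\,u::M_{f,\delta''}\{y::b\mid y_\triangleleft=y_\triangleright\}$ if $u::M_{f,\delta}\{y::b\mid y_\triangleleft=y_\triangleright\}$, $\mathcal G,x::b\vdash t::M_{f,\delta'}\{y::\mathbb B\mid y_\triangleleft=y_\triangleright\}$, and it is valid that the $\Delta_f$ of the left and the right instance of the whole expression is at most $\delta''$. **Corollary ($f$-divergence).** Let $\tau$ be a basic type or a type $\mathfrak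 D[b]$. If $\mathcal G\vdash e_1\sim e_2::M_{f,\delta}\{y::\tau\mid y_\triangleleft=y_\triangleright\}$, then for every valuation $\theta\models\mathcal G$ the pair of distributions $\mu_1=\llbracket e_1\rrbracket_{\theta_\triangleleft}$, $\mu_2=\llbracket e_2\rrbracket_{\theta_\triangleright}$ satisfies $\Delta_{\llbracket f\rrbracket_\theta}(\mu_1,\mu_2)\le\llbracket\delta\rrbracket_\theta$. In particular this holds for the empty environment, where $e_1,e_2,f,\delta$ are closed, and for $e_1=e_2=e$, i.e. for $\mathcal G\vdash e::M_{f,\delta}\{y::\tau\mid y_\triangleleft=y_\triangleright\}$. -/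

import Mathlib

open MeasureTheory ProbabilityTheory Filter
open scoped ENNReal NNReal Topology

namespace PrivInfer

noncomputable section

/-! ## f-divergences and liftings -/

/-- The class of divergence functions: convex on `(0, ∞)` and zero at `1`. Only the values of
`f` at positive arguments ever matter. -/
def ClassF (f : ℝ → ℝ) : Prop :=
  ConvexOn ℝ (Set.Ioi 0) f ∧ f 1 = 0

/-- The value of `f` at `0`, i.e. `lim_{t → 0+} f t` (which exists in `[-∞, ∞]` for convex `f`). -/
def atZero (f : ℝ → ℝ) : EReal :=
  limsup (fun t : ℝ => ((f t : ℝ) : EReal)) (𝓝[>] (0 : ℝ))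

/-- `lim_{u → ∞} f u / u` (which exists in `[-∞, ∞]` for convex `f`). -/
def slopeAtTop (f : ℝ → ℝ) : EReal :=
  limsup (fun u : ℝ => ((f u / u : ℝ) : EReal)) atTop

/-- The summand `q * f (p / q)`, with `0 * f (0 / 0) = 0` and
`0 * f (p / 0) = p * lim_{u → ∞} f u / u`. -/
def divTerm (f : ℝ → ℝ) (p q : ℝ≥0∞) : EReal :=
  open Classical in
  if q = 0 then
    if p = 0 then 0 else (p : EReal) * slopeAtTop f
  else
    (q : EReal) * (if p = 0 then atZero f else ((f (p / q).toReal : ℝ) : EReal))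

/-- The `f`-divergence `∑ a, ν a * f (μ a / ν a)`, as the sum of the positive parts of the
summands minus the sum of their negative parts (the latter is finite for `f` in `ClassF`). -/
def fDiv {A : Type} (f : ℝ → ℝ) (μ ν : PMF A) : EReal :=
  ((∑' a, (divTerm f (μ a) (ν a)).toENNReal : ℝ≥0∞) : EReal) -
    ((∑' a, (-divTerm f (μ a) (ν a)).toENNReal : ℝ≥0∞) : EReal)

/-- `(f₁, f₂)` are `f₃`-composable. -/
def Composable (f₁ f₂ f₃ : ℝ → ℝ) : Prop :=
  ClassF f₁ ∧ ClassF f₂ ∧ ClassF f₃ ∧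
    ∀ (A B : Type) (μ₁ μ₂ : PMF A) (M₁ M₂ : A → PMF B),
      fDiv f₃ (μ₁.bind M₁) (μ₂.bind M₂) ≤ fDiv f₁ μ₁ μ₂ + ⨆ v, fDiv f₂ (M₁ v) (M₂ v)

/-- The `(f, δ)`-lifting of a relation `Ψ`. -/
def Lifting {A B : Type} (f : ℝ → ℝ) (δ : ℝ≥0∞) (Ψ : A → B → Prop)
    (μ₁ : PMF A) (μ₂ : PMF B) : Prop :=
  ∃ μL μR : PMF (A × B),
    (∀ a b, 0 < μL (a, b) → Ψ a b) ∧ (∀ a b, 0 < μR (a, b) → Ψ a b) ∧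
    μL.map Prod.fst = μ₁ ∧ μR.map Prod.snd = μ₂ ∧ fDiv f μL μR ≤ (δ : EReal)

/-! ## Simple types -/

/-- The (strictly) positive reals. -/
abbrev PosReal : Type := {x : ℝ // 0 < x}

/-- Basic types. -/
inductive BTy : Type
  | unit | bool | nat | real
  /-- positive reals -/
  | posreal
  /-- nonnegative reals together with infinity -/
  | ereal
  /-- the unit interval -/
  | unitI
  | list (b : BTy)

/-- The types over which one can form the probability monad: basic types and types of symbolic
distributions over basic types. -/
inductive VTy : Type
  | base (b : BTy)
  | dist (b : BTy)

/-- Simple types. -/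
inductive Ty : Type
  | val (v : VTy)
  | mon (v : VTy)
  | arr (τ σ : Ty)

abbrev Ty.base (b : BTy) : Ty := .val (.base b)
abbrev Ty.dist (b : BTy) : Ty := .val (.dist b)

infixr:60 " ⇒ " => Ty.arr

/-- Interpretation of basic types. -/
@[reducible] def BTy.den : BTy → Type
  | .unit => Unit
  | .bool => Bool
  | .nat => ℕ
  | .real => ℝ
  | .posreal => PosReal
  | .ereal => ℝ≥0∞
  | .unitI => unitInterval
  | .list b => List b.den

def BTy.default : (b : BTy) → b.den
  | .unit => ()
  | .bool => false
  | .nat => (0 : ℕ)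
  | .real => (0 : ℝ)
  | .posreal => (⟨1, one_pos⟩ : PosReal)
  | .ereal => (0 : ℝ≥0∞)
  | .unitI => (0 : unitInterval)
  | .list _ => []

/-- The numeric basic types. -/
def BTy.numeric : BTy → Bool
  | .nat | .real | .posreal | .ereal | .unitI => true
  | .unit | .bool | .list _ => false

/-- The numeric value of an element of a numeric type (used for the assertion `e ≤ e'`). -/
def BTy.toEReal : (b : BTy) → b.den → EReal
  | .nat => fun n : ℕ => ((n : ℝ) : EReal)
  | .real => fun x : ℝ => (x : EReal)
  | .posreal => fun x : PosReal => ((x : ℝ) : EReal)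
  | .ereal => fun x : ℝ≥0∞ => (x : EReal)
  | .unitI => fun x : unitInterval => ((x : ℝ) : EReal)
  | .unit => fun _ => 0
  | .bool => fun _ => 0
  | .list _ => fun _ => 0

/-- Symbolic distributions: syntactic expressions with values as parameters. `Sym b` holds
further symbolic families over `b`, besides the four built-in ones. -/
inductive SymDist (Sym : BTy → Type) : BTy → Type
  | bernoulli (p : unitInterval) : SymDist Sym .bool
  /-- mean and variance -/
  | normal (m : ℝ) (v : PosReal) : SymDist Sym .real
  | beta (a b : PosReal) : SymDist Sym .unitI
  | uniform : SymDist Sym .unitI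
  | other {b : BTy} (s : Sym b) : SymDist Sym b

@[reducible] def VTy.den (Sym : BTy → Type) : VTy → Type
  | .base b => b.den
  | .dist b => SymDist Sym b

/-- Interpretation of simple types. -/
@[reducible] def Ty.den (Sym : BTy → Type) : Ty → Type
  | .val v => v.den Sym
  | .mon v => PMF (v.den Sym)
  | .arr τ σ => τ.den Sym → σ.den Sym

/-! ## Discrete versions of the basic distributions -/

/-- A probability measure on `ℝ`, rounded down to the grid of mesh `1 / N`. -/
def discretize (N : ℕ+) (μ : Measure ℝ) [IsProbabilityMeasure μ] : PMF ℝ :=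
  have : IsProbabilityMeasure (μ.map fun x : ℝ => ⌊x * (N : ℝ)⌋) :=
    Measure.isProbabilityMeasure_map
      (Int.measurable_floor.comp (measurable_id.mul_const (N : ℝ))).aemeasurable
  (μ.map fun x : ℝ => ⌊x * (N : ℝ)⌋).toPMF.map fun k : ℤ => (k : ℝ) / (N : ℝ)

/-- The same for probability measures that live on the unit interval. -/
def discretizeUnit (N : ℕ+) (μ : Measure ℝ) [IsProbabilityMeasure μ] : PMF unitInterval :=
  (discretize N μ).map (Set.projIcc (0 : ℝ) 1 zero_le_one)

def bernoulliPMF (p : unitInterval) : PMF Bool :=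
  PMF.ofFintype (fun b => ENNReal.ofReal (cond b (p : ℝ) (1 - p))) (by
    rw [Fintype.sum_bool, cond_true, cond_false,
      ← ENNReal.ofReal_add p.2.1 (sub_nonneg.2 p.2.2)]
    simp)

def normalPMF (N : ℕ+) (m : ℝ) (v : PosReal) : PMF ℝ :=
  discretize N (gaussianReal m (Real.toNNReal v))

def betaPMF (N : ℕ+) (a b : PosReal) : PMF unitInterval :=
  have : IsProbabilityMeasure (betaMeasure a b) := isProbabilityMeasureBeta a.2 b.2
  discretizeUnit N (betaMeasure a b)

theorem isProbabilityMeasure_restrict_Icc :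
    IsProbabilityMeasure ((volume : Measure ℝ).restrict (Set.Icc 0 1)) :=
  ⟨by simp⟩

def uniformPMF (N : ℕ+) : PMF unitInterval :=
  have := isProbabilityMeasure_restrict_Icc
  discretizeUnit N ((volume : Measure ℝ).restrict (Set.Icc 0 1))

/-- The Laplace distribution of scale `1 / ε`, centred at `x`. -/
def laplaceMeasure (ε : PosReal) (x : ℝ) : Measure ℝ :=
  volume.withDensity fun y => ENNReal.ofReal ((ε : ℝ) / 2 * Real.exp (-|y - x| * ε))

theorem isProbabilityMeasure_laplace (ε : PosReal) (x : ℝ) :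
    IsProbabilityMeasure (laplaceMeasure ε x) := by
  have hε : (0 : ℝ) < ε := ε.2
  have h1 : ∫ y : ℝ, (ε : ℝ) / 2 * Real.exp (-|y| * ε) = 1 := by
    rw [integral_comp_abs (f := fun t : ℝ => (ε : ℝ) / 2 * Real.exp (-t * ε)),
      integral_const_mul]
    have h2 : ∫ t in Set.Ioi (0 : ℝ), Real.exp (-t * ε) = 1 / ε := by
      have := integral_exp_mul_Ioi (a := -(ε : ℝ)) (by linarith) 0
      simp only [mul_zero, Real.exp_zero] at this
      rw [neg_div_neg_eq] at this
      rw [← this]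
      exact integral_congr_ae (Eventually.of_forall fun t => by ring_nf)
    rw [h2]
    field_simp
  have h3 : Integrable fun y : ℝ => (ε : ℝ) / 2 * Real.exp (-|y| * ε) :=
    Integrable.of_integral_ne_zero (by rw [h1]; exact one_ne_zero)
  refine ⟨?_⟩
  rw [laplaceMeasure, withDensity_apply _ MeasurableSet.univ, Measure.restrict_univ,
    lintegral_sub_right_eq_self (μ := volume)
      (fun y : ℝ => ENNReal.ofReal ((ε : ℝ) / 2 * Real.exp (-|y| * ε))) x,
    ← ofReal_integral_eq_lintegral_ofReal h3
      (Eventually.of_forall fun y => by positivity), h1, ENNReal.ofReal_one]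

def laplacePMF (N : ℕ+) (ε : PosReal) (x : ℝ) : PMF ℝ :=
  have := isProbabilityMeasure_laplace ε x
  discretize N (laplaceMeasure ε x)

/-- Gaussian noise of standard deviation `s`, added to `x`. -/
def gaussPMF (N : ℕ+) (s : PosReal) (x : ℝ) : PMF ℝ :=
  discretize N (gaussianReal x (Real.toNNReal ((s : ℝ) ^ 2)))

/-- The exponential mechanism: an output `r` in the range `R` is released with probability
proportional to `exp (q r * ε / 2)`. -/
def expPMF {A : Type} (R : Finset A) (hR : R.Nonempty) (ε : ℝ) (q : A → ℝ) : PMF A :=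
  open Classical in
  PMF.normalize (fun r => if r ∈ R then ENNReal.ofReal (Real.exp (q r * ε / 2)) else 0)
    (by
      obtain ⟨r, hr⟩ := hR
      intro h
      have := ENNReal.tsum_eq_zero.1 h r
      rw [if_pos hr, ENNReal.ofReal_eq_zero] at this
      exact absurd this (not_le.2 (Real.exp_pos _)))
    (by
      rw [tsum_eq_sum (s := R) (fun r hr => if_neg hr)]
      refine (ENNReal.sum_lt_top.2 fun r hr => ?_).ne
      rw [if_pos hr]
      exact ENNReal.ofReal_lt_top)

/-- The posterior: the prior `u`, weighted by the probability that the predicate `t` holds, and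
renormalized. Programs that observe an event of probability `0` have no meaning; `observePMF`
then returns the prior. -/
def observePMF {A : Type} (u : PMF A) (t : A → PMF Bool) : PMF A :=
  open Classical in
  if h : (∑' g, u g * t g true) = 0 then u
  else
    PMF.normalize (fun d => u d * t d true) h
      (ne_top_of_le_ne_top ENNReal.one_ne_top
        ((ENNReal.tsum_le_tsum fun g => mul_le_of_le_one_right' ((t g).coe_le_one true)).trans
          u.tsum_coe.le))

/-- The actual distribution that a symbolic distribution stands for. -/
def SymDist.law {Sym : BTy → Type} (N : ℕ+) (symLaw : ∀ b, Sym b → PMF b.den) :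
    {b : BTy} → SymDist Sym b → PMF b.den
  | _, .bernoulli p => bernoulliPMF p
  | _, .normal m v => normalPMF N m v
  | _, .beta a b => betaPMF N a b
  | _, .uniform => uniformPMF N
  | _, .other s => symLaw _ s

/-! ## The parameters of the language -/

/-- What the language is parametrized by. -/
structure Model : Type 1 where
  /-- further symbolic distributions, besides Bernoulli, normal, beta and uniform -/
  Sym : BTy → Type
  symLaw : ∀ b, Sym b → PMF b.den
  /-- the precision of the discrete versions of the continuous distributions -/
  precision : ℕ+
  /-- the inference algorithm; it never fails, and inference is exact -/
  algInf : ∀ b : BTy, PMF b.den → SymDist Sym b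
  algInf_exact : ∀ (b : BTy) (μ : PMF b.den), (algInf b μ).law precision symLaw = μ
  /-- the range of outputs of the exponential mechanism -/
  range : ∀ v : VTy, Finset (v.den Sym)
  range_nonempty : ∀ v, (range v).Nonempty
  /-- the set of constants, besides the built-in ones -/
  Con : Type
  conTy : Con → Ty
  conVal : ∀ c, (conTy c).den Sym

/-- Such parameters exist: take all discrete distributions as symbolic ones, and all values as
constants. -/
theorem Model.nonempty : Nonempty Model :=
  ⟨{ Sym := fun b => PMF b.den
     symLaw := fun _ s => s
     precision := 1
     algInf := fun _ μ => .other μ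
     algInf_exact := fun _ _ => rfl
     range := fun v => match v with
       | .base b => {b.default}
       | .dist b => {.other (PMF.pure b.default)}
     range_nonempty := fun v => by cases v <;> exact Finset.singleton_nonempty _
     Con := Σ τ : Ty, τ.den fun b => PMF b.den
     conTy := fun c => c.1
     conVal := fun c => c.2 }⟩

variable (𝓜 : Model)

abbrev VTy.Den (v : VTy) : Type := v.den 𝓜.Sym
abbrev Ty.Den (τ : Ty) : Type := τ.den 𝓜.Sym

def VTy.inhabitant : (v : VTy) → v.Den 𝓜
  | .base b => b.default
  | .dist b => 𝓜.algInf b (PMF.pure b.default)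

def Ty.inhabitant : (τ : Ty) → τ.Den 𝓜
  | .val v => v.inhabitant 𝓜
  | .mon v => PMF.pure (v.inhabitant 𝓜)
  | .arr _ σ => fun _ => σ.inhabitant

/-- The actual distribution that a symbolic distribution stands for. -/
def law {b : BTy} (d : SymDist 𝓜.Sym b) : PMF b.den :=
  d.law 𝓜.precision 𝓜.symLaw

/-! ## Expressions and their denotations

Expressions are intrinsically simply typed, with de Bruijn indices. -/

/-- Simple environments; the head is the variable bound last. -/
abbrev Ctx : Type := List Ty

inductive Var : Ctx → Ty → Type
  | z {Γ : Ctx} {τ : Ty} : Var (τ :: Γ) τ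
  | s {Γ : Ctx} {τ σ : Ty} (x : Var Γ τ) : Var (σ :: Γ) τ

/-- Constants: the constructors of the basic types, the probabilistic primitives, the mechanisms
(curried), and the constants of the model. -/
inductive Konst : Ty → Type
  | star : Konst (.base .unit)
  | tt : Konst (.base .bool)
  | ff : Konst (.base .bool)
  | zero : Konst (.base .nat)
  | succ : Konst (.base .nat ⇒ .base .nat)
  | nil (b : BTy) : Konst (.base (.list b))
  | cons (b : BTy) : Konst (.base b ⇒ .base (.list b) ⇒ .base (.list b))
  | uniform : Konst (.dist .unitI)
  | bernoulli : Konst (.base .unitI ⇒ .dist .bool)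
  | beta : Konst (.base .posreal ⇒ .base .posreal ⇒ .dist .unitI)
  | normal : Konst (.base .real ⇒ .base .posreal ⇒ .dist .real)
  | lapMech : Konst (.base .posreal ⇒ .base .real ⇒ .mon (.base .real))
  | gaussMech : Konst (.base .posreal ⇒ .base .real ⇒ .mon (.base .real))
  | expMech (D : Ty) (R : VTy) :
      Konst (.base .real ⇒ (D ⇒ .val R ⇒ .base .real) ⇒ D ⇒ .mon R)
  | con (c : 𝓜.Con) : Konst (𝓜.conTy c)

def Konst.den : {τ : Ty} → Konst 𝓜 τ → τ.Den 𝓜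
  | _, .star => ()
  | _, .tt => true
  | _, .ff => false
  | _, .zero => (0 : ℕ)
  | _, .succ => fun n : ℕ => (n + 1 : ℕ)
  | _, .nil b => ([] : List b.den)
  | _, .cons b => fun (h : b.den) (t : List b.den) => (h :: t : List b.den)
  | _, .uniform => SymDist.uniform
  | _, .bernoulli => fun p : unitInterval => SymDist.bernoulli p
  | _, .beta => fun (a b : PosReal) => SymDist.beta a b
  | _, .normal => fun (m : ℝ) (v : PosReal) => SymDist.normal m v
  | _, .lapMech => fun (ε : PosReal) (x : ℝ) => laplacePMF 𝓜.precision ε x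
  | _, .gaussMech => fun (s : PosReal) (x : ℝ) => gaussPMF 𝓜.precision s x
  | _, .expMech D R => fun (ε : ℝ) (q : D.Den 𝓜 → R.Den 𝓜 → ℝ) (d : D.Den 𝓜) =>
      expPMF (𝓜.range R) (𝓜.range_nonempty R) ε (q d)
  | _, .con c => 𝓜.conVal c

/-- Simply typed expressions. -/
inductive Expr : Ctx → Ty → Type
  | var {Γ : Ctx} {τ : Ty} (x : Var Γ τ) : Expr Γ τ
  | const {Γ : Ctx} {τ : Ty} (c : Konst 𝓜 τ) : Expr Γ τ
  | app {Γ : Ctx} {τ σ : Ty} (f : Expr Γ (τ ⇒ σ)) (a : Expr Γ τ) : Expr Γ σ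
  | lam {Γ : Ctx} {τ σ : Ty} (e : Expr (τ :: Γ) σ) : Expr Γ (τ ⇒ σ)
  /-- `letrec f x = e`; in `e`, index `0` is `f` and index `1` is `x` -/
  | letrec {Γ : Ctx} {τ σ : Ty} (e : Expr ((τ ⇒ σ) :: τ :: Γ) σ) : Expr Γ (τ ⇒ σ)
  | caseUnit {Γ : Ctx} {τ : Ty} (e : Expr Γ (.base .unit)) (e₀ : Expr Γ τ) : Expr Γ τ
  | caseBool {Γ : Ctx} {τ : Ty} (e : Expr Γ (.base .bool)) (et ef : Expr Γ τ) : Expr Γ τ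
  | caseNat {Γ : Ctx} {τ : Ty} (e : Expr Γ (.base .nat)) (e₀ : Expr Γ τ)
      (e₁ : Expr (.base .nat :: Γ) τ) : Expr Γ τ
  /-- in the second branch, index `0` is the tail and index `1` is the head -/
  | caseList {Γ : Ctx} {τ : Ty} {b : BTy} (e : Expr Γ (.base (.list b))) (e₀ : Expr Γ τ)
      (e₁ : Expr (.base (.list b) :: .base b :: Γ) τ) : Expr Γ τ
  | unitM {Γ : Ctx} {v : VTy} (e : Expr Γ (.val v)) : Expr Γ (.mon v)
  /-- `mlet x = e₁ in e₂` -/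
  | bindM {Γ : Ctx} {v w : VTy} (e₁ : Expr Γ (.mon v)) (e₂ : Expr (.val v :: Γ) (.mon w)) :
      Expr Γ (.mon w)
  /-- `observe x ⇒ t in u` -/
  | observe {Γ : Ctx} {b : BTy} (t : Expr (.base b :: Γ) (.mon (.base .bool)))
      (u : Expr Γ (.mon (.base b))) : Expr Γ (.mon (.base b))
  | infer {Γ : Ctx} {b : BTy} (e : Expr Γ (.mon (.base b))) : Expr Γ (.dist b)
  | ran {Γ : Ctx} {b : BTy} (e : Expr Γ (.dist b)) : Expr Γ (.mon (.base b))

/-- Valuations of a simple environment. -/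
def Env (Γ : Ctx) : Type := ∀ τ : Ty, Var Γ τ → τ.Den 𝓜

variable {𝓜}

def Env.nil : Env 𝓜 [] := fun _ x => nomatch x

def Env.cons {Γ : Ctx} {τ : Ty} (d : τ.Den 𝓜) (θ : Env 𝓜 Γ) : Env 𝓜 (τ :: Γ)
  | _, .z => d
  | _, .s x => θ _ x

def Env.tail {Γ : Ctx} {τ : Ty} (θ : Env 𝓜 (τ :: Γ)) : Env 𝓜 Γ := fun _ x => θ _ (.s x)

def boolCase {A : Type} : Bool → A → A → A
  | true, a, _ => a
  | false, _, a => a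

def natCase {A : Type} : ℕ → A → (ℕ → A) → A
  | 0, a, _ => a
  | n + 1, _, f => f n

def listCase {X A : Type} : List X → A → (X → List X → A) → A
  | [], a, _ => a
  | h :: t, _, f => f h t

/-- `g` solves the recursive equation `g a = F g a`. -/
def IsRec {A B : Type} (F : (A → B) → A → B) (g : A → B) : Prop := ∀ a, g a = F g a

/-- The unique solution of the recursive equation, or `default` if there is not exactly one. -/
def recVal {A B : Type} (F : (A → B) → A → B) (default : A → B) : A → B :=
  open Classical in if h : ∃! g, IsRec F g then h.choose else default

/-- The denotation of an expression. A recursive definition denotes the function that is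
determined by its recursive equation (and has no meaning, hence an arbitrary value here, if
there is no such function or more than one). -/
def Expr.den : {Γ : Ctx} → {τ : Ty} → Expr 𝓜 Γ τ → Env 𝓜 Γ → τ.Den 𝓜
  | _, _, .var x, θ => θ _ x
  | _, _, .const c, _ => c.den
  | _, _, .app f a, θ => f.den θ (a.den θ)
  | _, _, .lam e, θ => fun d => e.den (Env.cons d θ)
  | _, _, .letrec (τ := τ) (σ := σ) e, θ =>
      recVal (A := τ.Den 𝓜) (B := σ.Den 𝓜)
        (fun g a => e.den (Env.cons (τ := τ ⇒ σ) g (Env.cons a θ))) ((τ ⇒ σ).inhabitant 𝓜)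
  | _, _, .caseUnit _ e₀, θ => e₀.den θ
  | _, _, .caseBool e et ef, θ => boolCase (e.den θ) (et.den θ) (ef.den θ)
  | _, _, .caseNat e e₀ e₁, θ =>
      natCase (e.den θ) (e₀.den θ) fun n => e₁.den (Env.cons (τ := .base .nat) n θ)
  | _, _, .caseList (b := b) e e₀ e₁, θ =>
      listCase (X := b.den) (e.den θ) (e₀.den θ) fun h t =>
        e₁.den (Env.cons (τ := .base (.list b)) t (Env.cons (τ := .base b) h θ))
  | _, _, .unitM (v := v) e, θ => PMF.pure (e.den θ : v.Den 𝓜)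
  | _, _, .bindM (v := v) (w := w) e₁ e₂, θ =>
      PMF.bind (e₁.den θ : PMF (v.Den 𝓜))
        fun g => (e₂.den (Env.cons (τ := .val v) g θ) : PMF (w.Den 𝓜))
  | _, _, .observe (b := b) t u, θ =>
      observePMF (u.den θ : PMF b.den)
        fun d => (t.den (Env.cons (τ := .base b) d θ) : PMF Bool)
  | _, _, .infer (b := b) e, θ => 𝓜.algInf b (e.den θ)
  | _, _, .ran (b := b) e, θ => law 𝓜 (e.den θ : SymDist 𝓜.Sym b)

/-! ### Renaming and substitution -/

abbrev Ren (Γ Δ : Ctx) : Type := ∀ τ : Ty, Var Γ τ → Var Δ τ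

def Ren.lift {Γ Δ : Ctx} (ρ : Ren Γ Δ) (σ : Ty) : Ren (σ :: Γ) (σ :: Δ)
  | _, .z => .z
  | _, .s x => .s (ρ _ x)

def Ren.lift2 {Γ Δ : Ctx} (ρ : Ren Γ Δ) (σ : Ty) : Ren (σ :: σ :: Γ) (σ :: σ :: Δ) :=
  (ρ.lift σ).lift σ

def Ren.wk (Γ : Ctx) (σ : Ty) : Ren Γ (σ :: Γ) := fun _ x => .s x

def Ren.wk2 (Γ : Ctx) (σ : Ty) : Ren Γ (σ :: σ :: Γ) := fun _ x => .s (.s x)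

def Expr.ren : {Γ : Ctx} → {τ : Ty} → Expr 𝓜 Γ τ → {Δ : Ctx} → Ren Γ Δ → Expr 𝓜 Δ τ
  | _, _, .var x, _, ρ => .var (ρ _ x)
  | _, _, .const c, _, _ => .const c
  | _, _, .app f a, _, ρ => .app (f.ren ρ) (a.ren ρ)
  | _, _, .lam e, _, ρ => .lam (e.ren (ρ.lift _))
  | _, _, .letrec e, _, ρ => .letrec (e.ren ((ρ.lift _).lift _))
  | _, _, .caseUnit e e₀, _, ρ => .caseUnit (e.ren ρ) (e₀.ren ρ)
  | _, _, .caseBool e et ef, _, ρ => .caseBool (e.ren ρ) (et.ren ρ) (ef.ren ρ)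
  | _, _, .caseNat e e₀ e₁, _, ρ => .caseNat (e.ren ρ) (e₀.ren ρ) (e₁.ren (ρ.lift _))
  | _, _, .caseList e e₀ e₁, _, ρ =>
      .caseList (e.ren ρ) (e₀.ren ρ) (e₁.ren ((ρ.lift _).lift _))
  | _, _, .unitM e, _, ρ => .unitM (e.ren ρ)
  | _, _, .bindM e₁ e₂, _, ρ => .bindM (e₁.ren ρ) (e₂.ren (ρ.lift _))
  | _, _, .observe t u, _, ρ => .observe (t.ren (ρ.lift _)) (u.ren ρ)
  | _, _, .infer e, _, ρ => .infer (e.ren ρ)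
  | _, _, .ran e, _, ρ => .ran (e.ren ρ)

abbrev Expr.wk {Γ : Ctx} {τ : Ty} (e : Expr 𝓜 Γ τ) (σ : Ty) : Expr 𝓜 (σ :: Γ) τ :=
  e.ren (Ren.wk Γ σ)

abbrev Expr.wk2 {Γ : Ctx} {τ : Ty} (e : Expr 𝓜 Γ τ) (σ : Ty) : Expr 𝓜 (σ :: σ :: Γ) τ :=
  e.ren (Ren.wk2 Γ σ)

abbrev Sub (𝓜 : Model) (Γ Δ : Ctx) : Type := ∀ τ : Ty, Var Γ τ → Expr 𝓜 Δ τ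

def Sub.lift {Γ Δ : Ctx} (ς : Sub 𝓜 Γ Δ) (σ : Ty) : Sub 𝓜 (σ :: Γ) (σ :: Δ)
  | _, .z => .var .z
  | _, .s x => (ς _ x).wk σ

def Sub.lift2 {Γ Δ : Ctx} (ς : Sub 𝓜 Γ Δ) (σ : Ty) : Sub 𝓜 (σ :: σ :: Γ) (σ :: σ :: Δ) :=
  (ς.lift σ).lift σ

/-- Substitute `a` for index `0` and `b` for index `1`. -/
def Sub.inst2 {Γ : Ctx} {σ : Ty} (a b : Expr 𝓜 Γ σ) : Sub 𝓜 (σ :: σ :: Γ) Γ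
  | _, .z => a
  | _, .s .z => b
  | _, .s (.s x) => .var x

def Expr.subst : {Γ : Ctx} → {τ : Ty} → Expr 𝓜 Γ τ → {Δ : Ctx} → Sub 𝓜 Γ Δ → Expr 𝓜 Δ τ
  | _, _, .var x, _, ς => ς _ x
  | _, _, .const c, _, _ => .const c
  | _, _, .app f a, _, ς => .app (f.subst ς) (a.subst ς)
  | _, _, .lam e, _, ς => .lam (e.subst (ς.lift _))
  | _, _, .letrec e, _, ς => .letrec (e.subst ((ς.lift _).lift _))
  | _, _, .caseUnit e e₀, _, ς => .caseUnit (e.subst ς) (e₀.subst ς)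
  | _, _, .caseBool e et ef, _, ς => .caseBool (e.subst ς) (et.subst ς) (ef.subst ς)
  | _, _, .caseNat e e₀ e₁, _, ς => .caseNat (e.subst ς) (e₀.subst ς) (e₁.subst (ς.lift _))
  | _, _, .caseList e e₀ e₁, _, ς =>
      .caseList (e.subst ς) (e₀.subst ς) (e₁.subst ((ς.lift _).lift _))
  | _, _, .unitM e, _, ς => .unitM (e.subst ς)
  | _, _, .bindM e₁ e₂, _, ς => .bindM (e₁.subst ς) (e₂.subst (ς.lift _))
  | _, _, .observe t u, _, ς => .observe (t.subst (ς.lift _)) (u.subst ς)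
  | _, _, .infer e, _, ς => .infer (e.subst ς)
  | _, _, .ran e, _, ς => .ran (e.subst ς)

/-! ## Relational types and assertions

They live over an environment that holds both instances of every relational variable (and the
plain variables that quantifiers bind). A relational binder binds two variables: index `0` is the
left instance and index `1` is the right instance. Relational types are indexed by the simple
type that they erase to. -/

/-- The simple type of the first index of the monad: functions from positive reals to reals. -/
abbrev FTy : Ty := .base .posreal ⇒ .base .real

variable (𝓜)

mutual
  inductive RTy : Ctx → Ty → Type
    /-- basic types and types of symbolic distributions -/
    | val {Γ : Ctx} (v : VTy) : RTy Γ (.val v)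
    /-- the monadic type with indices `f` and `δ` -/
    | mon {Γ : Ctx} {v : VTy} (f : Expr 𝓜 Γ FTy) (δ : Expr 𝓜 Γ (.base .ereal))
        (T : RTy Γ (.val v)) : RTy Γ (.mon v)
    /-- the dependent product of `U` over `x :: T` -/
    | pi {Γ : Ctx} {τ σ : Ty} (T : RTy Γ τ) (U : RTy (τ :: τ :: Γ) σ) : RTy Γ (τ ⇒ σ)
    /-- the refinement type `{x :: T | φ}` -/
    | ref {Γ : Ctx} {τ : Ty} (T : RTy Γ τ) (φ : Assn (τ :: τ :: Γ)) : RTy Γ τ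
  inductive Assn : Ctx → Type
    | all {Γ : Ctx} (τ : Ty) (φ : Assn (τ :: Γ)) : Assn Γ
    | ex {Γ : Ctx} (τ : Ty) (φ : Assn (τ :: Γ)) : Assn Γ
    | rall {Γ : Ctx} {τ : Ty} (T : RTy Γ τ) (φ : Assn (τ :: τ :: Γ)) : Assn Γ
    | rex {Γ : Ctx} {τ : Ty} (T : RTy Γ τ) (φ : Assn (τ :: τ :: Γ)) : Assn Γ
    /-- the `f`-divergence of two symbolic distributions is at most `δ` -/
    | divDist {Γ : Ctx} {b : BTy} (f : Expr 𝓜 Γ FTy) (e₁ e₂ : Expr 𝓜 Γ (.dist b))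
        (δ : Expr 𝓜 Γ (.base .ereal)) : Assn Γ
    /-- the `f`-divergence of two actual distributions is at most `δ` -/
    | divMon {Γ : Ctx} {v : VTy} (f : Expr 𝓜 Γ FTy) (e₁ e₂ : Expr 𝓜 Γ (.mon v))
        (δ : Expr 𝓜 Γ (.base .ereal)) : Assn Γ
    | inF {Γ : Ctx} (f : Expr 𝓜 Γ FTy) : Assn Γ
    | eq {Γ : Ctx} {τ : Ty} (e₁ e₂ : Expr 𝓜 Γ τ) : Assn Γ
    | le {Γ : Ctx} (b : BTy) (hb : b.numeric = true) (e₁ e₂ : Expr 𝓜 Γ (.base b)) : Assn Γ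
    | top {Γ : Ctx} : Assn Γ
    | bot {Γ : Ctx} : Assn Γ
    | not {Γ : Ctx} (φ : Assn Γ) : Assn Γ
    | or {Γ : Ctx} (φ ψ : Assn Γ) : Assn Γ
    | and {Γ : Ctx} (φ ψ : Assn Γ) : Assn Γ
    | imp {Γ : Ctx} (φ ψ : Assn Γ) : Assn Γ
end

variable {𝓜}

mutual
  def RTy.ren : {Γ : Ctx} → {τ : Ty} → RTy 𝓜 Γ τ → {Δ : Ctx} → Ren Γ Δ → RTy 𝓜 Δ τ
    | _, _, .val v, _, _ => .val v
    | _, _, .mon f δ T, _, ρ => .mon (f.ren ρ) (δ.ren ρ) (T.ren ρ)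
    | _, _, .pi T U, _, ρ => .pi (T.ren ρ) (U.ren (ρ.lift2 _))
    | _, _, .ref T φ, _, ρ => .ref (T.ren ρ) (φ.ren (ρ.lift2 _))
  def Assn.ren : {Γ : Ctx} → Assn 𝓜 Γ → {Δ : Ctx} → Ren Γ Δ → Assn 𝓜 Δ
    | _, .all τ φ, _, ρ => .all τ (φ.ren (ρ.lift _))
    | _, .ex τ φ, _, ρ => .ex τ (φ.ren (ρ.lift _))
    | _, .rall T φ, _, ρ => .rall (T.ren ρ) (φ.ren (ρ.lift2 _))
    | _, .rex T φ, _, ρ => .rex (T.ren ρ) (φ.ren (ρ.lift2 _))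
    | _, .divDist f e₁ e₂ δ, _, ρ => .divDist (f.ren ρ) (e₁.ren ρ) (e₂.ren ρ) (δ.ren ρ)
    | _, .divMon f e₁ e₂ δ, _, ρ => .divMon (f.ren ρ) (e₁.ren ρ) (e₂.ren ρ) (δ.ren ρ)
    | _, .inF f, _, ρ => .inF (f.ren ρ)
    | _, .eq e₁ e₂, _, ρ => .eq (e₁.ren ρ) (e₂.ren ρ)
    | _, .le b hb e₁ e₂, _, ρ => .le b hb (e₁.ren ρ) (e₂.ren ρ)
    | _, .top, _, _ => .top
    | _, .bot, _, _ => .bot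
    | _, .not φ, _, ρ => .not (φ.ren ρ)
    | _, .or φ ψ, _, ρ => .or (φ.ren ρ) (ψ.ren ρ)
    | _, .and φ ψ, _, ρ => .and (φ.ren ρ) (ψ.ren ρ)
    | _, .imp φ ψ, _, ρ => .imp (φ.ren ρ) (ψ.ren ρ)
end

mutual
  def RTy.subst : {Γ : Ctx} → {τ : Ty} → RTy 𝓜 Γ τ → {Δ : Ctx} → Sub 𝓜 Γ Δ → RTy 𝓜 Δ τ
    | _, _, .val v, _, _ => .val v
    | _, _, .mon f δ T, _, ς => .mon (f.subst ς) (δ.subst ς) (T.subst ς)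
    | _, _, .pi T U, _, ς => .pi (T.subst ς) (U.subst (ς.lift2 _))
    | _, _, .ref T φ, _, ς => .ref (T.subst ς) (φ.subst (ς.lift2 _))
  def Assn.subst : {Γ : Ctx} → Assn 𝓜 Γ → {Δ : Ctx} → Sub 𝓜 Γ Δ → Assn 𝓜 Δ
    | _, .all τ φ, _, ς => .all τ (φ.subst (ς.lift _))
    | _, .ex τ φ, _, ς => .ex τ (φ.subst (ς.lift _))
    | _, .rall T φ, _, ς => .rall (T.subst ς) (φ.subst (ς.lift2 _))
    | _, .rex T φ, _, ς => .rex (T.subst ς) (φ.subst (ς.lift2 _))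
    | _, .divDist f e₁ e₂ δ, _, ς =>
        .divDist (f.subst ς) (e₁.subst ς) (e₂.subst ς) (δ.subst ς)
    | _, .divMon f e₁ e₂ δ, _, ς =>
        .divMon (f.subst ς) (e₁.subst ς) (e₂.subst ς) (δ.subst ς)
    | _, .inF f, _, ς => .inF (f.subst ς)
    | _, .eq e₁ e₂, _, ς => .eq (e₁.subst ς) (e₂.subst ς)
    | _, .le b hb e₁ e₂, _, ς => .le b hb (e₁.subst ς) (e₂.subst ς)
    | _, .top, _, _ => .top
    | _, .bot, _, _ => .bot
    | _, .not φ, _, ς => .not (φ.subst ς)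
    | _, .or φ ψ, _, ς => .or (φ.subst ς) (ψ.subst ς)
    | _, .and φ ψ, _, ς => .and (φ.subst ς) (ψ.subst ς)
    | _, .imp φ ψ, _, ς => .imp (φ.subst ς) (ψ.subst ς)
end

abbrev RTy.wk2 {Γ : Ctx} {τ : Ty} (T : RTy 𝓜 Γ τ) (σ : Ty) : RTy 𝓜 (σ :: σ :: Γ) τ :=
  T.ren (Ren.wk2 Γ σ)

/-- The refinement `{y :: v | y◁ = y▷}`. -/
abbrev RTy.diag {Γ : Ctx} (v : VTy) : RTy 𝓜 Γ (.val v) :=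
  .ref (.val v) (.eq (.var .z) (.var (.s .z)))

/-- A function on the positive reals, as a function on `ℝ` (with irrelevant values elsewhere). -/
def extend (g : PosReal → ℝ) : ℝ → ℝ :=
  open Classical in fun x => if h : 0 < x then g ⟨x, h⟩ else 0

/-- The divergence function denoted by an index `f`. -/
def Expr.denF {Γ : Ctx} (f : Expr 𝓜 Γ FTy) (θ : Env 𝓜 Γ) : ℝ → ℝ := extend (f.den θ)

/-- The number in `[0, ∞]` denoted by an index `δ`. -/
def Expr.denE {Γ : Ctx} (δ : Expr 𝓜 Γ (.base .ereal)) (θ : Env 𝓜 Γ) : ℝ≥0∞ := δ.den θ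

/-- The distribution denoted by a monadic expression. -/
def Expr.denM {Γ : Ctx} {v : VTy} (e : Expr 𝓜 Γ (.mon v)) (θ : Env 𝓜 Γ) : PMF (v.Den 𝓜) :=
  e.den θ

/-- The distribution that the value of an expression of symbolic type stands for. -/
def Expr.denD {Γ : Ctx} {b : BTy} (e : Expr 𝓜 Γ (.dist b)) (θ : Env 𝓜 Γ) : PMF b.den :=
  law 𝓜 (e.den θ)

/-- Extend a valuation by a left and a right value. -/
abbrev Env.cons2 {Γ : Ctx} {τ : Ty} (d₁ d₂ : τ.Den 𝓜) (θ : Env 𝓜 Γ) : Env 𝓜 (τ :: τ :: Γ) :=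
  Env.cons d₁ (Env.cons d₂ θ)

mutual
  /-- The relational interpretation of relational types. -/
  def RTy.den : {Γ : Ctx} → {τ : Ty} → RTy 𝓜 Γ τ → Env 𝓜 Γ → τ.Den 𝓜 → τ.Den 𝓜 → Prop
    | _, _, .val _, _ => fun _ _ => True
    | _, _, .mon (v := v) f δ T, θ => fun (μ₁ μ₂ : PMF (v.Den 𝓜)) =>
        Lifting (f.denF θ) (δ.denE θ) (T.den θ) μ₁ μ₂
    | _, _, .pi (τ := τ) T U, θ => fun f₁ f₂ =>
        ∀ d₁ d₂ : τ.Den 𝓜, T.den θ d₁ d₂ → U.den (Env.cons2 d₁ d₂ θ) (f₁ d₁) (f₂ d₂)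
    | _, _, .ref T φ, θ => fun d₁ d₂ => T.den θ d₁ d₂ ∧ φ.den (Env.cons2 d₁ d₂ θ)
  /-- The interpretation of assertions. -/
  def Assn.den : {Γ : Ctx} → Assn 𝓜 Γ → Env 𝓜 Γ → Prop
    | _, .all τ φ, θ => ∀ d : τ.Den 𝓜, φ.den (Env.cons d θ)
    | _, .ex τ φ, θ => ∃ d : τ.Den 𝓜, φ.den (Env.cons d θ)
    | _, .rall (τ := τ) T φ, θ =>
        ∀ d₁ d₂ : τ.Den 𝓜, T.den θ d₁ d₂ → φ.den (Env.cons2 d₁ d₂ θ)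
    | _, .rex (τ := τ) T φ, θ =>
        ∃ d₁ d₂ : τ.Den 𝓜, T.den θ d₁ d₂ ∧ φ.den (Env.cons2 d₁ d₂ θ)
    | _, .divDist f e₁ e₂ δ, θ => fDiv (f.denF θ) (e₁.denD θ) (e₂.denD θ) ≤ (δ.denE θ : EReal)
    | _, .divMon f e₁ e₂ δ, θ => fDiv (f.denF θ) (e₁.denM θ) (e₂.denM θ) ≤ (δ.denE θ : EReal)
    | _, .inF f, θ => ClassF (f.denF θ)
    | _, .eq e₁ e₂, θ => e₁.den θ = e₂.den θ
    | _, .le b _ e₁ e₂, θ => b.toEReal (e₁.den θ) ≤ b.toEReal (e₂.den θ)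
    | _, .top, _ => True
    | _, .bot, _ => False
    | _, .not φ, θ => ¬ φ.den θ
    | _, .or φ ψ, θ => φ.den θ ∨ ψ.den θ
    | _, .and φ ψ, θ => φ.den θ ∧ ψ.den θ
    | _, .imp φ ψ, θ => φ.den θ → ψ.den θ
end

/-! ## Relational environments -/

/-- The environment that holds a left and a right instance of every variable of `Γ`. -/
@[reducible] def dbl : Ctx → Ctx
  | [] => []
  | τ :: Γ => τ :: τ :: dbl Γ

def dblL : {Γ : Ctx} → Ren Γ (dbl Γ)
  | _ :: _, _, .z => .z
  | _ :: _, _, .s x => .s (.s (dblL _ x))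

def dblR : {Γ : Ctx} → Ren Γ (dbl Γ)
  | _ :: _, _, .z => .s .z
  | _ :: _, _, .s x => .s (.s (dblR _ x))

/-- `e◁`: the variables of `e` are read as left instances. -/
abbrev Expr.L {Γ : Ctx} {τ : Ty} (e : Expr 𝓜 Γ τ) : Expr 𝓜 (dbl Γ) τ := e.ren dblL

/-- `e▷`: the variables of `e` are read as right instances. -/
abbrev Expr.R {Γ : Ctx} {τ : Ty} (e : Expr 𝓜 Γ τ) : Expr 𝓜 (dbl Γ) τ := e.ren dblR

variable (𝓜) in
/-- Relational environments, indexed by their erasure. -/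
inductive RCtx : Ctx → Type
  | nil : RCtx []
  | cons {Γ : Ctx} {τ : Ty} (G : RCtx Γ) (T : RTy 𝓜 (dbl Γ) τ) : RCtx (τ :: Γ)

def RCtx.lookup : {Γ : Ctx} → {τ : Ty} → RCtx 𝓜 Γ → Var Γ τ → RTy 𝓜 (dbl Γ) τ
  | _, _, .cons _ T, .z => T.wk2 _
  | _, _, .cons G _, .s x => (G.lookup x).wk2 _

/-- `θ` validates the relational environment `G`. -/
def RCtx.Valid : {Γ : Ctx} → RCtx 𝓜 Γ → Env 𝓜 (dbl Γ) → Prop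
  | _, .nil, _ => True
  | _, .cons (Γ := Γ) (τ := τ) G T, (θ : Env 𝓜 (τ :: τ :: dbl Γ)) =>
      G.Valid θ.tail.tail ∧ T.den θ.tail.tail (θ _ .z) (θ _ (.s .z))

/-- An assertion is valid in `G` if it holds under all valuations that validate `G`. -/
def RCtx.Entails {Γ : Ctx} (G : RCtx 𝓜 Γ) (φ : Assn 𝓜 (dbl Γ)) : Prop :=
  ∀ θ, G.Valid θ → φ.den θ

/-! ## Relational subtyping and typing -/

/-- Relational subtyping `G ⊢ T ≼ U`. -/
inductive Subtyping : {Γ : Ctx} → {τ : Ty} → RCtx 𝓜 Γ → RTy 𝓜 (dbl Γ) τ → RTy 𝓜 (dbl Γ) τ → Prop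
  | refl {Γ : Ctx} {τ : Ty} (G : RCtx 𝓜 Γ) (T : RTy 𝓜 (dbl Γ) τ) : Subtyping G T T
  | trans {Γ : Ctx} {τ : Ty} {G : RCtx 𝓜 Γ} {T U V : RTy 𝓜 (dbl Γ) τ} :
      Subtyping G T U → Subtyping G U V → Subtyping G T V
  | left {Γ : Ctx} {τ : Ty} {G : RCtx 𝓜 Γ} {T : RTy 𝓜 (dbl Γ) τ} {φ : Assn 𝓜 (dbl (τ :: Γ))} :
      Subtyping G (.ref T φ) T
  | right {Γ : Ctx} {τ : Ty} {G : RCtx 𝓜 Γ} {T U : RTy 𝓜 (dbl Γ) τ}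
      {φ : Assn 𝓜 (dbl (τ :: Γ))} :
      Subtyping G T U → (G.cons T).Entails φ → Subtyping G T (.ref U φ)
  | pi {Γ : Ctx} {τ σ : Ty} {G : RCtx 𝓜 Γ} {T₁ T₂ : RTy 𝓜 (dbl Γ) τ}
      {U₁ U₂ : RTy 𝓜 (dbl (τ :: Γ)) σ} :
      Subtyping G T₂ T₁ → Subtyping (G.cons T₂) U₁ U₂ → Subtyping G (.pi T₁ U₁) (.pi T₂ U₂)
  /-- The index `f₂` has to be the weaker one, i.e. the pointwise smaller one (as `ε₂-D` is for
  `ε₁ ≤ ε₂`), and `δ₂` the larger one. -/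
  | mon {Γ : Ctx} {v : VTy} {G : RCtx 𝓜 Γ} {T U : RTy 𝓜 (dbl Γ) (.val v)}
      {f₁ f₂ : Expr 𝓜 (dbl Γ) FTy} {δ₁ δ₂ : Expr 𝓜 (dbl Γ) (.base .ereal)} :
      Subtyping G T U → G.Entails (.inF f₁) → G.Entails (.inF f₂) →
      (∀ θ : Env 𝓜 (dbl (.val v :: Γ)), (G.cons T).Valid θ →
        (∀ x : ℝ, 0 < x → (f₂.wk2 (.val v)).denF θ x ≤ (f₁.wk2 (.val v)).denF θ x) ∧
        (δ₁.wk2 (.val v)).denE θ ≤ (δ₂.wk2 (.val v)).denE θ ∧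
        (δ₂.wk2 (.val v)).denE θ < ∞) →
      Subtyping G (.mon f₁ δ₁ T) (.mon f₂ δ₂ U)

/-- The relational environment `G` extended with the assumption `φ` (as a refined binding of a
variable of type unit, which does not occur in `φ`). -/
abbrev RCtx.assume {Γ : Ctx} (G : RCtx 𝓜 Γ) (φ : Assn 𝓜 (dbl Γ)) : RCtx 𝓜 (.base .unit :: Γ) :=
  G.cons (.ref (.val (.base .unit)) (φ.ren (Ren.wk2 (dbl Γ) (.base .unit))))

/-- `e = true`, `e = false`, and so on, over an environment that also holds the variables which
stand for the arguments of the constructor. -/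
abbrev Assn.isTrue {Γ : Ctx} (e : Expr 𝓜 Γ (.base .bool)) : Assn 𝓜 Γ := .eq e (.const .tt)
abbrev Assn.isFalse {Γ : Ctx} (e : Expr 𝓜 Γ (.base .bool)) : Assn 𝓜 Γ := .eq e (.const .ff)
abbrev Assn.isZero {Γ : Ctx} (e : Expr 𝓜 Γ (.base .nat)) : Assn 𝓜 Γ := .eq e (.const .zero)
abbrev Assn.isNil {Γ : Ctx} {b : BTy} (e : Expr 𝓜 Γ (.base (.list b))) : Assn 𝓜 Γ :=
  .eq e (.const (.nil b))
abbrev Assn.isSucc {Γ : Ctx} (e n : Expr 𝓜 Γ (.base .nat)) : Assn 𝓜 Γ :=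
  .eq e (.app (.const .succ) n)
abbrev Assn.isCons {Γ : Ctx} {b : BTy} (e : Expr 𝓜 Γ (.base (.list b)))
    (h : Expr 𝓜 Γ (.base b)) (t : Expr 𝓜 Γ (.base (.list b))) : Assn 𝓜 Γ :=
  .eq e (.app (.app (.const (.cons b)) h) t)

/-- `e◁ = n◁ + 1`, for a relational variable `n` bound on top of the environment of `e`. -/
abbrev succL {Γ : Ctx} (e : Expr 𝓜 Γ (.base .nat)) : Assn 𝓜 (dbl (.base .nat :: Γ)) :=
  .isSucc (e.L.wk2 _) (.var .z)
/-- `e▷ = n▷ + 1`. -/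
abbrev succR {Γ : Ctx} (e : Expr 𝓜 Γ (.base .nat)) : Assn 𝓜 (dbl (.base .nat :: Γ)) :=
  .isSucc (e.R.wk2 _) (.var (.s .z))
/-- `e◁ = h◁ :: t◁`, for relational variables `h` and `t` bound on top of the environment of
`e`. -/
abbrev consL {Γ : Ctx} {b : BTy} (e : Expr 𝓜 Γ (.base (.list b))) :
    Assn 𝓜 (dbl (.base (.list b) :: .base b :: Γ)) :=
  .isCons ((e.L.wk2 _).wk2 _) (.var (.s (.s .z))) (.var .z)
/-- `e▷ = h▷ :: t▷`. -/
abbrev consR {Γ : Ctx} {b : BTy} (e : Expr 𝓜 Γ (.base (.list b))) :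
    Assn 𝓜 (dbl (.base (.list b) :: .base b :: Γ)) :=
  .isCons ((e.R.wk2 _).wk2 _) (.var (.s (.s (.s .z)))) (.var (.s .z))

/-- The environment `G, n :: {nat | φ}`. -/
abbrev RCtx.pushNat {Γ : Ctx} (G : RCtx 𝓜 Γ) (φ : Assn 𝓜 (dbl (.base .nat :: Γ))) :
    RCtx 𝓜 (.base .nat :: Γ) :=
  G.cons (.ref (.val (.base .nat)) φ)
/-- The environment `G, h :: b, t :: {list b | φ}`. -/
abbrev RCtx.pushList {Γ : Ctx} {b : BTy} (G : RCtx 𝓜 Γ)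
    (φ : Assn 𝓜 (dbl (.base (.list b) :: .base b :: Γ))) :
    RCtx 𝓜 (.base (.list b) :: .base b :: Γ) :=
  (G.cons (.val (.base b))).cons (.ref (.val (.base (.list b))) φ)

/-- The left (or right) half of a valuation. -/
def Env.left {Γ : Ctx} (θ : Env 𝓜 (dbl Γ)) : Env 𝓜 Γ := fun _ x => θ _ (dblL _ x)
def Env.right {Γ : Ctx} (θ : Env 𝓜 (dbl Γ)) : Env 𝓜 Γ := fun _ x => θ _ (dblR _ x)

/-- The recursive definition `letrec f x = e` is well defined under `θ`: its equation determines
a total function. -/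
def Defined {Γ : Ctx} {τ σ : Ty} (e : Expr 𝓜 ((τ ⇒ σ) :: τ :: Γ) σ) (θ : Env 𝓜 Γ) : Prop :=
  ∃! g : τ.Den 𝓜 → σ.Den 𝓜,
    IsRec (fun g a => e.den (Env.cons (τ := τ ⇒ σ) g (Env.cons a θ))) g

/-- The type of the recursive variable `f` in the body of `letrec f x = e`, where `x :: T`: the
function may be called at arguments `y :: T` that precede `x` in the termination order `ψ`. -/
abbrev recTy {Δ : Ctx} {τ σ : Ty} (T : RTy 𝓜 Δ τ) (ψ : Assn 𝓜 (τ :: τ :: τ :: τ :: Δ))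
    (U : RTy 𝓜 (τ :: τ :: Δ) σ) : RTy 𝓜 (τ :: τ :: Δ) (τ ⇒ σ) :=
  .pi (.ref (T.wk2 τ) ψ) (U.ren ((Ren.wk2 Δ τ).lift2 τ))

/-- Relational typing `G ⊢ e₁ ∼ e₂ :: T`. The free variables of `e₁` are read as left instances
and those of `e₂` as right instances, so that `G ⊢ e :: T` is `Typing G e e T`. -/
inductive Typing : {Γ : Ctx} → {τ : Ty} →
    RCtx 𝓜 Γ → Expr 𝓜 Γ τ → Expr 𝓜 Γ τ → RTy 𝓜 (dbl Γ) τ → Prop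
  | var {Γ : Ctx} {τ : Ty} (G : RCtx 𝓜 Γ) (x : Var Γ τ) :
      Typing G (.var x) (.var x) (G.lookup x)
  /-- a primitive or a constant has every relational type that its meaning has -/
  | const {Γ : Ctx} {τ : Ty} {G : RCtx 𝓜 Γ} {c : Konst 𝓜 τ} {T : RTy 𝓜 (dbl Γ) τ} :
      (∀ θ, G.Valid θ → T.den θ c.den c.den) →
      Typing G (.const c) (.const c) T
  | lam {Γ : Ctx} {τ σ : Ty} {G : RCtx 𝓜 Γ} {T : RTy 𝓜 (dbl Γ) τ}
      {U : RTy 𝓜 (dbl (τ :: Γ)) σ} {e e' : Expr 𝓜 (τ :: Γ) σ} :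
      Typing (G.cons T) e e' U →
      Typing G (.lam e) (.lam e') (.pi T U)
  | app {Γ : Ctx} {τ σ : Ty} {G : RCtx 𝓜 Γ} {T : RTy 𝓜 (dbl Γ) τ}
      {U : RTy 𝓜 (τ :: τ :: dbl Γ) σ} {f f' : Expr 𝓜 Γ (τ ⇒ σ)} {a a' : Expr 𝓜 Γ τ} :
      Typing G f f' (.pi T U) → Typing G a a' T →
      Typing G (.app f a) (.app f' a') (U.subst (Sub.inst2 a.L a'.R))
  | letrec {Γ : Ctx} {τ σ : Ty} {G : RCtx 𝓜 Γ} {T : RTy 𝓜 (dbl Γ) τ}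
      {U : RTy 𝓜 (dbl (τ :: Γ)) σ} {e e' : Expr 𝓜 ((τ ⇒ σ) :: τ :: Γ) σ}
      (ψ : Assn 𝓜 (τ :: τ :: τ :: τ :: dbl Γ)) :
      (∀ θ, G.Valid θ → Defined e θ.left ∧ Defined e' θ.right) →
      (∀ θ, G.Valid θ → WellFounded fun y x : τ.Den 𝓜 × τ.Den 𝓜 =>
        ψ.den (Env.cons2 y.1 y.2 (Env.cons2 x.1 x.2 θ))) →
      Typing ((G.cons T).cons (recTy T ψ U)) e e' (U.wk2 (τ ⇒ σ)) →
      Typing G (.letrec e) (.letrec e') (.pi T U)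
  /-- subsumption -/
  | sub {Γ : Ctx} {τ : Ty} {G : RCtx 𝓜 Γ} {T U : RTy 𝓜 (dbl Γ) τ} {e e' : Expr 𝓜 Γ τ} :
      Typing G e e' T → Subtyping G T U → Typing G e e' U
  /-- a valid assertion about the two expressions may be added as a refinement -/
  | refine {Γ : Ctx} {τ : Ty} {G : RCtx 𝓜 Γ} {T : RTy 𝓜 (dbl Γ) τ} {e e' : Expr 𝓜 Γ τ}
      {φ : Assn 𝓜 (τ :: τ :: dbl Γ)} :
      Typing G e e' T → G.Entails (φ.subst (Sub.inst2 e.L e'.R)) → Typing G e e' (.ref T φ)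
  /-- conversion; in particular reduction on either side -/
  | conv {Γ : Ctx} {τ : Ty} {G : RCtx 𝓜 Γ} {T : RTy 𝓜 (dbl Γ) τ} {e e' d d' : Expr 𝓜 Γ τ} :
      Typing G e e' T → G.Entails (.eq d.L e.L) → G.Entails (.eq d'.R e'.R) → Typing G d d' T
  | caseUnit {Γ : Ctx} {τ : Ty} {G : RCtx 𝓜 Γ} {T : RTy 𝓜 (dbl Γ) τ}
      {S : RTy 𝓜 (dbl Γ) (.base .unit)} {s s' : Expr 𝓜 Γ (.base .unit)} {e e' : Expr 𝓜 Γ τ} :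
      Typing G s s' S → Typing G e e' T → Typing G (.caseUnit s e) (.caseUnit s' e') T
  | caseBool {Γ : Ctx} {τ : Ty} {G : RCtx 𝓜 Γ} {T : RTy 𝓜 (dbl Γ) τ}
      {S : RTy 𝓜 (dbl Γ) (.base .bool)} {s s' : Expr 𝓜 Γ (.base .bool)}
      {et et' ef ef' : Expr 𝓜 Γ τ} :
      Typing G s s' S →
      G.Entails (.eq s.L s'.R) →
      Typing (G.assume (.and (.isTrue s.L) (.isTrue s'.R))) (et.wk _) (et'.wk _) (T.wk2 _) →
      Typing (G.assume (.and (.isFalse s.L) (.isFalse s'.R))) (ef.wk _) (ef'.wk _) (T.wk2 _) →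
      Typing G (.caseBool s et ef) (.caseBool s' et' ef') T
  | caseBoolL {Γ : Ctx} {τ : Ty} {G : RCtx 𝓜 Γ} {T : RTy 𝓜 (dbl Γ) τ}
      {s : Expr 𝓜 Γ (.base .bool)} {et ef e' : Expr 𝓜 Γ τ} :
      Typing (G.assume (.isTrue s.L)) (et.wk _) (e'.wk _) (T.wk2 _) →
      Typing (G.assume (.isFalse s.L)) (ef.wk _) (e'.wk _) (T.wk2 _) →
      Typing G (.caseBool s et ef) e' T
  | caseBoolR {Γ : Ctx} {τ : Ty} {G : RCtx 𝓜 Γ} {T : RTy 𝓜 (dbl Γ) τ}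
      {s' : Expr 𝓜 Γ (.base .bool)} {e et' ef' : Expr 𝓜 Γ τ} :
      Typing (G.assume (.isTrue s'.R)) (e.wk _) (et'.wk _) (T.wk2 _) →
      Typing (G.assume (.isFalse s'.R)) (e.wk _) (ef'.wk _) (T.wk2 _) →
      Typing G e (.caseBool s' et' ef') T
  | caseNat {Γ : Ctx} {τ : Ty} {G : RCtx 𝓜 Γ} {T : RTy 𝓜 (dbl Γ) τ}
      {S : RTy 𝓜 (dbl Γ) (.base .nat)} {s s' : Expr 𝓜 Γ (.base .nat)}
      {e₀ e₀' : Expr 𝓜 Γ τ} {e₁ e₁' : Expr 𝓜 (.base .nat :: Γ) τ} :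
      Typing G s s' S →
      G.Entails (.and (.imp (.isZero s.L) (.isZero s'.R)) (.imp (.isZero s'.R) (.isZero s.L))) →
      Typing (G.assume (.and (.isZero s.L) (.isZero s'.R))) (e₀.wk _) (e₀'.wk _) (T.wk2 _) →
      Typing (G.pushNat (.and (succL s) (succR s'))) e₁ e₁' (T.wk2 _) →
      Typing G (.caseNat s e₀ e₁) (.caseNat s' e₀' e₁') T
  | caseNatL {Γ : Ctx} {τ : Ty} {G : RCtx 𝓜 Γ} {T : RTy 𝓜 (dbl Γ) τ}
      {s : Expr 𝓜 Γ (.base .nat)} {e₀ e' : Expr 𝓜 Γ τ} {e₁ : Expr 𝓜 (.base .nat :: Γ) τ} :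
      Typing (G.assume (.isZero s.L)) (e₀.wk _) (e'.wk _) (T.wk2 _) →
      Typing (G.pushNat (succL s)) e₁ (e'.wk _) (T.wk2 _) →
      Typing G (.caseNat s e₀ e₁) e' T
  | caseNatR {Γ : Ctx} {τ : Ty} {G : RCtx 𝓜 Γ} {T : RTy 𝓜 (dbl Γ) τ}
      {s' : Expr 𝓜 Γ (.base .nat)} {e e₀' : Expr 𝓜 Γ τ} {e₁' : Expr 𝓜 (.base .nat :: Γ) τ} :
      Typing (G.assume (.isZero s'.R)) (e.wk _) (e₀'.wk _) (T.wk2 _) →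
      Typing (G.pushNat (succR s')) (e.wk _) e₁' (T.wk2 _) →
      Typing G e (.caseNat s' e₀' e₁') T
  | caseList {Γ : Ctx} {τ : Ty} {b : BTy} {G : RCtx 𝓜 Γ} {T : RTy 𝓜 (dbl Γ) τ}
      {S : RTy 𝓜 (dbl Γ) (.base (.list b))} {s s' : Expr 𝓜 Γ (.base (.list b))}
      {e₀ e₀' : Expr 𝓜 Γ τ} {e₁ e₁' : Expr 𝓜 (.base (.list b) :: .base b :: Γ) τ} :
      Typing G s s' S →
      G.Entails (.and (.imp (.isNil s.L) (.isNil s'.R)) (.imp (.isNil s'.R) (.isNil s.L))) →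
      Typing (G.assume (.and (.isNil s.L) (.isNil s'.R))) (e₀.wk _) (e₀'.wk _) (T.wk2 _) →
      Typing (G.pushList (.and (consL s) (consR s'))) e₁ e₁' ((T.wk2 _).wk2 _) →
      Typing G (.caseList s e₀ e₁) (.caseList s' e₀' e₁') T
  | caseListL {Γ : Ctx} {τ : Ty} {b : BTy} {G : RCtx 𝓜 Γ} {T : RTy 𝓜 (dbl Γ) τ}
      {s : Expr 𝓜 Γ (.base (.list b))} {e₀ e' : Expr 𝓜 Γ τ}
      {e₁ : Expr 𝓜 (.base (.list b) :: .base b :: Γ) τ} :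
      Typing (G.assume (.isNil s.L)) (e₀.wk _) (e'.wk _) (T.wk2 _) →
      Typing (G.pushList (consL s)) e₁ ((e'.wk _).wk _) ((T.wk2 _).wk2 _) →
      Typing G (.caseList s e₀ e₁) e' T
  | caseListR {Γ : Ctx} {τ : Ty} {b : BTy} {G : RCtx 𝓜 Γ} {T : RTy 𝓜 (dbl Γ) τ}
      {s' : Expr 𝓜 Γ (.base (.list b))} {e e₀' : Expr 𝓜 Γ τ}
      {e₁' : Expr 𝓜 (.base (.list b) :: .base b :: Γ) τ} :
      Typing (G.assume (.isNil s'.R)) (e.wk _) (e₀'.wk _) (T.wk2 _) →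
      Typing (G.pushList (consR s')) ((e.wk _).wk _) e₁' ((T.wk2 _).wk2 _) →
      Typing G e (.caseList s' e₀' e₁') T
  | unitM {Γ : Ctx} {v : VTy} {G : RCtx 𝓜 Γ} {T : RTy 𝓜 (dbl Γ) (.val v)}
      {e e' : Expr 𝓜 Γ (.val v)} {f : Expr 𝓜 (dbl Γ) FTy} {δ : Expr 𝓜 (dbl Γ) (.base .ereal)} :
      G.Entails (.inF f) → Typing G e e' T →
      Typing G (.unitM e) (.unitM e') (.mon f δ T)
  | bindM {Γ : Ctx} {v w : VTy} {G : RCtx 𝓜 Γ}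
      {T₁ : RTy 𝓜 (dbl Γ) (.val v)} {T₂ : RTy 𝓜 (dbl Γ) (.val w)}
      {e₁ e₁' : Expr 𝓜 Γ (.mon v)} {e₂ e₂' : Expr 𝓜 (.val v :: Γ) (.mon w)}
      {f₁ f₂ f₃ : Expr 𝓜 (dbl Γ) FTy} {δ₁ δ₂ δ₃ : Expr 𝓜 (dbl Γ) (.base .ereal)} :
      Typing G e₁ e₁' (.mon f₁ δ₁ T₁) →
      (∀ θ, G.Valid θ → Composable (f₁.denF θ) (f₂.denF θ) (f₃.denF θ)) →
      (∀ θ, G.Valid θ → δ₃.denE θ = δ₁.denE θ + δ₂.denE θ) →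
      Typing (G.cons T₁) e₂ e₂' (.mon (f₂.wk2 _) (δ₂.wk2 _) (T₂.wk2 _)) →
      Typing G (.bindM e₁ e₂) (.bindM e₁' e₂') (.mon f₃ δ₃ T₂)
  | infer {Γ : Ctx} {b : BTy} {G : RCtx 𝓜 Γ} {e e' : Expr 𝓜 Γ (.mon (.base b))}
      {f : Expr 𝓜 (dbl Γ) FTy} {δ : Expr 𝓜 (dbl Γ) (.base .ereal)} :
      Typing G e e' (.mon f δ (.diag (.base b))) →
      Typing G (.infer e) (.infer e')
        (.ref (.val (.dist b)) (.divDist (f.wk2 _) (.var .z) (.var (.s .z)) (δ.wk2 _)))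
  | ran {Γ : Ctx} {b : BTy} {G : RCtx 𝓜 Γ} {e e' : Expr 𝓜 Γ (.dist b)}
      {f : Expr 𝓜 (dbl Γ) FTy} {δ : Expr 𝓜 (dbl Γ) (.base .ereal)} :
      Typing G e e'
        (.ref (.val (.dist b)) (.divDist (f.wk2 _) (.var .z) (.var (.s .z)) (δ.wk2 _))) →
      Typing G (.ran e) (.ran e') (.mon f δ (.diag (.base b)))
  | observe {Γ : Ctx} {b : BTy} {G : RCtx 𝓜 Γ} {u u' : Expr 𝓜 Γ (.mon (.base b))}
      {t t' : Expr 𝓜 (.base b :: Γ) (.mon (.base .bool))}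
      {f : Expr 𝓜 (dbl Γ) FTy} {δ δ' δ'' : Expr 𝓜 (dbl Γ) (.base .ereal)} :
      Typing G u u' (.mon f δ (.diag (.base b))) →
      Typing (G.cons (.val (.base b))) t t'
        (.mon (f.wk2 _) (δ'.wk2 _) (.diag (.base .bool))) →
      G.Entails (.divMon f (Expr.observe t u).L (Expr.observe t' u').R δ'') →
      Typing G (.observe t u) (.observe t' u') (.mon f δ'' (.diag (.base b)))

end

end PrivInfer

/-!
Typing is sound for the relational interpretation (`Typing.sound`): a derivation of
`G ⊢ e₁ ∼ e₂ :: T` puts the pair of the left and the right denotation into the interpretation of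
`T`, under every valuation that validates `G`. For the type `M_{f,δ} {y :: v | y◁ = y▷}` this says
that the two distributions are in the `(f, δ)`-lifting of equality, which amounts to a bound on
their divergence (`lifting_eq_iff`): couplings on the diagonal are determined by their projections
and have the same divergence, since the summands off the diagonal vanish.

Soundness is an induction on derivations, in which renamings and substitutions are moved into
valuations (`RTy.den_ren`, `RTy.den_subst`). The probabilistic rules rest on three facts about
liftings. Dirac distributions at related values are lifted with divergence `f 1 = 0`
(`Lifting.pure`). Liftings are monotone in the relation and in both indices (`Lifting.mono`), as
the divergence is monotone in `f`. Liftings compose along `PMF.bind` (`Lifting.bind`), by applying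
composability of the divergences to the couplings instead of the distributions that they project
to. The rules for `infer` and `ran` use that inference is exact, and a recursive definition is
handled by well-founded induction on the pair of arguments. Convexity of `f` plays no role beyond
what composability provides.
-/

/-! ### Renaming and substitution -/

namespace PrivInfer

variable {𝓜 : Model}

/-- The valuation of `Γ` obtained from a valuation of `Δ` along a renaming. -/
def Env.pull {Γ Δ : Ctx} (θ : Env 𝓜 Δ) (ρ : Ren Γ Δ) : Env 𝓜 Γ := fun τ x => θ τ (ρ τ x)

/-- The valuation of `Γ` obtained from a valuation of `Δ` along a substitution. -/
noncomputable def Env.pullSub {Γ Δ : Ctx} (θ : Env 𝓜 Δ) (ς : Sub 𝓜 Γ Δ) : Env 𝓜 Γ :=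
  fun τ x => (ς τ x).den θ

@[simp] theorem Env.pull_lift {Γ Δ : Ctx} {σ : Ty} (θ : Env 𝓜 Δ) (ρ : Ren Γ Δ) (d : σ.Den 𝓜) :
    (Env.cons d θ).pull (ρ.lift σ) = Env.cons d (θ.pull ρ) := by
  funext τ x
  cases x <;> rfl

@[simp] theorem Env.pull_lift2 {Γ Δ : Ctx} {σ : Ty} (θ : Env 𝓜 Δ) (ρ : Ren Γ Δ)
    (d₁ d₂ : σ.Den 𝓜) :
    (Env.cons2 d₁ d₂ θ).pull (ρ.lift2 σ) = Env.cons2 d₁ d₂ (θ.pull ρ) := by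
  simp [Ren.lift2, Env.cons2]

@[simp] theorem Env.pull_wk {Γ : Ctx} {σ : Ty} (θ : Env 𝓜 Γ) (d : σ.Den 𝓜) :
    (Env.cons d θ).pull (Ren.wk Γ σ) = θ := rfl

@[simp] theorem Env.pull_wk2 {Γ : Ctx} {σ : Ty} (θ : Env 𝓜 Γ) (d₁ d₂ : σ.Den 𝓜) :
    (Env.cons2 d₁ d₂ θ).pull (Ren.wk2 Γ σ) = θ := rfl

@[simp] theorem Expr.den_ren {Γ : Ctx} {τ : Ty} (e : Expr 𝓜 Γ τ) {Δ : Ctx} (ρ : Ren Γ Δ)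
    (θ : Env 𝓜 Δ) : (e.ren ρ).den θ = e.den (θ.pull ρ) := by
  induction e generalizing Δ with
  | var x => rfl
  | const c => rfl
  | app f a hf ha => simp only [Expr.ren, Expr.den, hf, ha]
  | lam e h => simp only [Expr.ren, Expr.den, h, Env.pull_lift]
  | letrec e h => simp only [Expr.ren, Expr.den, h, Env.pull_lift]
  | caseUnit e e₀ h h₀ => simp only [Expr.ren, Expr.den, h₀]
  | caseBool e et ef h ht hf => simp only [Expr.ren, Expr.den, h, ht, hf]
  | caseNat e e₀ e₁ h h₀ h₁ => simp only [Expr.ren, Expr.den, h, h₀, h₁, Env.pull_lift]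
  | caseList e e₀ e₁ h h₀ h₁ => simp only [Expr.ren, Expr.den, h, h₀, h₁, Env.pull_lift]
  | unitM e h => simp only [Expr.ren, Expr.den, h]
  | bindM e₁ e₂ h₁ h₂ => simp only [Expr.ren, Expr.den, h₁, h₂, Env.pull_lift]
  | observe t u ht hu => simp only [Expr.ren, Expr.den, ht, hu, Env.pull_lift]
  | infer e h => simp only [Expr.ren, Expr.den, h]
  | ran e h => simp only [Expr.ren, Expr.den, h]

@[simp] theorem Env.pullSub_lift {Γ Δ : Ctx} {σ : Ty} (θ : Env 𝓜 Δ) (ς : Sub 𝓜 Γ Δ)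
    (d : σ.Den 𝓜) : (Env.cons d θ).pullSub (ς.lift σ) = Env.cons d (θ.pullSub ς) := by
  funext τ x
  cases x with
  | z => rfl
  | s x => exact Expr.den_ren _ _ _

@[simp] theorem Env.pullSub_lift2 {Γ Δ : Ctx} {σ : Ty} (θ : Env 𝓜 Δ) (ς : Sub 𝓜 Γ Δ)
    (d₁ d₂ : σ.Den 𝓜) :
    (Env.cons2 d₁ d₂ θ).pullSub (ς.lift2 σ) = Env.cons2 d₁ d₂ (θ.pullSub ς) := by
  simp [Sub.lift2, Env.cons2]

@[simp] theorem Env.pullSub_inst2 {Γ : Ctx} {σ : Ty} (θ : Env 𝓜 Γ) (a b : Expr 𝓜 Γ σ) :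
    θ.pullSub (Sub.inst2 a b) = Env.cons2 (a.den θ) (b.den θ) θ := by
  funext τ x
  match x with
  | .z => rfl
  | .s .z => rfl
  | .s (.s x) => rfl

@[simp] theorem Expr.den_subst {Γ : Ctx} {τ : Ty} (e : Expr 𝓜 Γ τ) {Δ : Ctx} (ς : Sub 𝓜 Γ Δ)
    (θ : Env 𝓜 Δ) : (e.subst ς).den θ = e.den (θ.pullSub ς) := by
  induction e generalizing Δ with
  | var x => rfl
  | const c => rfl
  | app f a hf ha => simp only [Expr.subst, Expr.den, hf, ha]
  | lam e h => simp only [Expr.subst, Expr.den, h, Env.pullSub_lift]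
  | letrec e h => simp only [Expr.subst, Expr.den, h, Env.pullSub_lift]
  | caseUnit e e₀ h h₀ => simp only [Expr.subst, Expr.den, h₀]
  | caseBool e et ef h ht hf => simp only [Expr.subst, Expr.den, h, ht, hf]
  | caseNat e e₀ e₁ h h₀ h₁ => simp only [Expr.subst, Expr.den, h, h₀, h₁, Env.pullSub_lift]
  | caseList e e₀ e₁ h h₀ h₁ => simp only [Expr.subst, Expr.den, h, h₀, h₁, Env.pullSub_lift]
  | unitM e h => simp only [Expr.subst, Expr.den, h]
  | bindM e₁ e₂ h₁ h₂ => simp only [Expr.subst, Expr.den, h₁, h₂, Env.pullSub_lift]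
  | observe t u ht hu => simp only [Expr.subst, Expr.den, ht, hu, Env.pullSub_lift]
  | infer e h => simp only [Expr.subst, Expr.den, h]
  | ran e h => simp only [Expr.subst, Expr.den, h]

section

variable {Γ Δ : Ctx}

@[simp] theorem Expr.denF_ren (f : Expr 𝓜 Γ FTy) (ρ : Ren Γ Δ) (θ : Env 𝓜 Δ) :
    (f.ren ρ).denF θ = f.denF (θ.pull ρ) := congrArg extend (f.den_ren ρ θ)

@[simp] theorem Expr.denE_ren (δ : Expr 𝓜 Γ (.base .ereal)) (ρ : Ren Γ Δ) (θ : Env 𝓜 Δ) :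
    (δ.ren ρ).denE θ = δ.denE (θ.pull ρ) := δ.den_ren ρ θ

@[simp] theorem Expr.denM_ren {v : VTy} (e : Expr 𝓜 Γ (.mon v)) (ρ : Ren Γ Δ) (θ : Env 𝓜 Δ) :
    (e.ren ρ).denM θ = e.denM (θ.pull ρ) := e.den_ren ρ θ

@[simp] theorem Expr.denD_ren {b : BTy} (e : Expr 𝓜 Γ (.dist b)) (ρ : Ren Γ Δ) (θ : Env 𝓜 Δ) :
    (e.ren ρ).denD θ = e.denD (θ.pull ρ) := congrArg (law 𝓜) (e.den_ren ρ θ)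

@[simp] theorem Expr.denF_subst (f : Expr 𝓜 Γ FTy) (ς : Sub 𝓜 Γ Δ) (θ : Env 𝓜 Δ) :
    (f.subst ς).denF θ = f.denF (θ.pullSub ς) := congrArg extend (f.den_subst ς θ)

@[simp] theorem Expr.denE_subst (δ : Expr 𝓜 Γ (.base .ereal)) (ς : Sub 𝓜 Γ Δ) (θ : Env 𝓜 Δ) :
    (δ.subst ς).denE θ = δ.denE (θ.pullSub ς) := δ.den_subst ς θ

@[simp] theorem Expr.denM_subst {v : VTy} (e : Expr 𝓜 Γ (.mon v)) (ς : Sub 𝓜 Γ Δ)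
    (θ : Env 𝓜 Δ) : (e.subst ς).denM θ = e.denM (θ.pullSub ς) := e.den_subst ς θ

@[simp] theorem Expr.denD_subst {b : BTy} (e : Expr 𝓜 Γ (.dist b)) (ς : Sub 𝓜 Γ Δ)
    (θ : Env 𝓜 Δ) : (e.subst ς).denD θ = e.denD (θ.pullSub ς) :=
  congrArg (law 𝓜) (e.den_subst ς θ)

end

mutual
  theorem RTy.den_ren : ∀ {Γ : Ctx} {τ : Ty} (T : RTy 𝓜 Γ τ) {Δ : Ctx} (ρ : Ren Γ Δ)
      (θ : Env 𝓜 Δ), (T.ren ρ).den θ = T.den (θ.pull ρ)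
    | _, _, .val v, _, ρ, θ => by simp only [RTy.ren, RTy.den]
    | _, _, .mon f δ T, _, ρ, θ => by
        simp only [RTy.ren, RTy.den, RTy.den_ren T, Expr.denF_ren, Expr.denE_ren]
    | _, _, .pi T U, _, ρ, θ => by
        simp only [RTy.ren, RTy.den, RTy.den_ren T, RTy.den_ren U, Env.pull_lift2]
    | _, _, .ref T φ, _, ρ, θ => by
        simp only [RTy.ren, RTy.den, RTy.den_ren T, Assn.den_ren φ, Env.pull_lift2]
  theorem Assn.den_ren : ∀ {Γ : Ctx} (φ : Assn 𝓜 Γ) {Δ : Ctx} (ρ : Ren Γ Δ)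
      (θ : Env 𝓜 Δ), (φ.ren ρ).den θ = φ.den (θ.pull ρ)
    | _, .all τ φ, _, ρ, θ => by
        simp only [Assn.ren, Assn.den, Assn.den_ren φ, Env.pull_lift]
    | _, .ex τ φ, _, ρ, θ => by
        simp only [Assn.ren, Assn.den, Assn.den_ren φ, Env.pull_lift]
    | _, .rall T φ, _, ρ, θ => by
        simp only [Assn.ren, Assn.den, RTy.den_ren T, Assn.den_ren φ, Env.pull_lift2]
    | _, .rex T φ, _, ρ, θ => by
        simp only [Assn.ren, Assn.den, RTy.den_ren T, Assn.den_ren φ, Env.pull_lift2]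
    | _, .divDist f e₁ e₂ δ, _, ρ, θ => by
        simp only [Assn.ren, Assn.den, Expr.denF_ren, Expr.denE_ren, Expr.denD_ren]
    | _, .divMon f e₁ e₂ δ, _, ρ, θ => by
        simp only [Assn.ren, Assn.den, Expr.denF_ren, Expr.denE_ren, Expr.denM_ren]
    | _, .inF f, _, ρ, θ => by simp only [Assn.ren, Assn.den, Expr.denF_ren]
    | _, .eq e₁ e₂, _, ρ, θ => by simp only [Assn.ren, Assn.den, Expr.den_ren]
    | _, .le b hb e₁ e₂, _, ρ, θ => by simp only [Assn.ren, Assn.den, Expr.den_ren]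
    | _, .top, _, ρ, θ => by simp only [Assn.ren, Assn.den]
    | _, .bot, _, ρ, θ => by simp only [Assn.ren, Assn.den]
    | _, .not φ, _, ρ, θ => by simp only [Assn.ren, Assn.den, Assn.den_ren φ]
    | _, .or φ ψ, _, ρ, θ => by
        simp only [Assn.ren, Assn.den, Assn.den_ren φ, Assn.den_ren ψ]
    | _, .and φ ψ, _, ρ, θ => by
        simp only [Assn.ren, Assn.den, Assn.den_ren φ, Assn.den_ren ψ]
    | _, .imp φ ψ, _, ρ, θ => by
        simp only [Assn.ren, Assn.den, Assn.den_ren φ, Assn.den_ren ψ]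
end

mutual
  theorem RTy.den_subst : ∀ {Γ : Ctx} {τ : Ty} (T : RTy 𝓜 Γ τ) {Δ : Ctx} (ς : Sub 𝓜 Γ Δ)
      (θ : Env 𝓜 Δ), (T.subst ς).den θ = T.den (θ.pullSub ς)
    | _, _, .val v, _, ς, θ => by simp only [RTy.subst, RTy.den]
    | _, _, .mon f δ T, _, ς, θ => by
        simp only [RTy.subst, RTy.den, RTy.den_subst T, Expr.denF_subst, Expr.denE_subst]
    | _, _, .pi T U, _, ς, θ => by
        simp only [RTy.subst, RTy.den, RTy.den_subst T, RTy.den_subst U, Env.pullSub_lift2]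
    | _, _, .ref T φ, _, ς, θ => by
        simp only [RTy.subst, RTy.den, RTy.den_subst T, Assn.den_subst φ, Env.pullSub_lift2]
  theorem Assn.den_subst : ∀ {Γ : Ctx} (φ : Assn 𝓜 Γ) {Δ : Ctx} (ς : Sub 𝓜 Γ Δ)
      (θ : Env 𝓜 Δ), (φ.subst ς).den θ = φ.den (θ.pullSub ς)
    | _, .all τ φ, _, ς, θ => by
        simp only [Assn.subst, Assn.den, Assn.den_subst φ, Env.pullSub_lift]
    | _, .ex τ φ, _, ς, θ => by
        simp only [Assn.subst, Assn.den, Assn.den_subst φ, Env.pullSub_lift]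
    | _, .rall T φ, _, ς, θ => by
        simp only [Assn.subst, Assn.den, RTy.den_subst T, Assn.den_subst φ, Env.pullSub_lift2]
    | _, .rex T φ, _, ς, θ => by
        simp only [Assn.subst, Assn.den, RTy.den_subst T, Assn.den_subst φ, Env.pullSub_lift2]
    | _, .divDist f e₁ e₂ δ, _, ς, θ => by
        simp only [Assn.subst, Assn.den, Expr.denF_subst, Expr.denE_subst, Expr.denD_subst]
    | _, .divMon f e₁ e₂ δ, _, ς, θ => by
        simp only [Assn.subst, Assn.den, Expr.denF_subst, Expr.denE_subst, Expr.denM_subst]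
    | _, .inF f, _, ς, θ => by simp only [Assn.subst, Assn.den, Expr.denF_subst]
    | _, .eq e₁ e₂, _, ς, θ => by simp only [Assn.subst, Assn.den, Expr.den_subst]
    | _, .le b hb e₁ e₂, _, ς, θ => by simp only [Assn.subst, Assn.den, Expr.den_subst]
    | _, .top, _, ς, θ => by simp only [Assn.subst, Assn.den]
    | _, .bot, _, ς, θ => by simp only [Assn.subst, Assn.den]
    | _, .not φ, _, ς, θ => by simp only [Assn.subst, Assn.den, Assn.den_subst φ]
    | _, .or φ ψ, _, ς, θ => by
        simp only [Assn.subst, Assn.den, Assn.den_subst φ, Assn.den_subst ψ]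
    | _, .and φ ψ, _, ς, θ => by
        simp only [Assn.subst, Assn.den, Assn.den_subst φ, Assn.den_subst ψ]
    | _, .imp φ ψ, _, ς, θ => by
        simp only [Assn.subst, Assn.den, Assn.den_subst φ, Assn.den_subst ψ]
end

/-! ### Valuations of relational environments -/

@[simp] theorem Env.left_cons2 {Γ : Ctx} {τ : Ty} (d₁ d₂ : τ.Den 𝓜) (θ : Env 𝓜 (dbl Γ)) :
    Env.left (Γ := τ :: Γ) (Env.cons2 d₁ d₂ θ) = Env.cons d₁ θ.left := by
  funext σ x
  cases x <;> rfl

@[simp] theorem Env.right_cons2 {Γ : Ctx} {τ : Ty} (d₁ d₂ : τ.Den 𝓜) (θ : Env 𝓜 (dbl Γ)) :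
    Env.right (Γ := τ :: Γ) (Env.cons2 d₁ d₂ θ) = Env.cons d₂ θ.right := by
  funext σ x
  cases x <;> rfl

theorem Env.left_cons2_cons2 {Γ : Ctx} {τ σ : Ty} (x₁ x₂ : σ.Den 𝓜) (d₁ d₂ : τ.Den 𝓜)
    (θ : Env 𝓜 (dbl Γ)) :
    Env.left (Γ := σ :: τ :: Γ) (Env.cons2 x₁ x₂ (Env.cons2 d₁ d₂ θ)) =
      Env.cons x₁ (Env.cons d₁ θ.left) := by
  rw [Env.left_cons2 (Γ := τ :: Γ), Env.left_cons2]

theorem Env.right_cons2_cons2 {Γ : Ctx} {τ σ : Ty} (x₁ x₂ : σ.Den 𝓜) (d₁ d₂ : τ.Den 𝓜)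
    (θ : Env 𝓜 (dbl Γ)) :
    Env.right (Γ := σ :: τ :: Γ) (Env.cons2 x₁ x₂ (Env.cons2 d₁ d₂ θ)) =
      Env.cons x₂ (Env.cons d₂ θ.right) := by
  rw [Env.right_cons2 (Γ := τ :: Γ), Env.right_cons2]

@[simp] theorem Env.pull_dblL {Γ : Ctx} (θ : Env 𝓜 (dbl Γ)) : θ.pull dblL = θ.left := rfl

@[simp] theorem Env.pull_dblR {Γ : Ctx} (θ : Env 𝓜 (dbl Γ)) : θ.pull dblR = θ.right := rfl

@[simp] theorem Expr.den_L {Γ : Ctx} {τ : Ty} (e : Expr 𝓜 Γ τ) (θ : Env 𝓜 (dbl Γ)) :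
    e.L.den θ = e.den θ.left := e.den_ren _ _

@[simp] theorem Expr.den_R {Γ : Ctx} {τ : Ty} (e : Expr 𝓜 Γ τ) (θ : Env 𝓜 (dbl Γ)) :
    e.R.den θ = e.den θ.right := e.den_ren _ _

theorem Expr.den_wk {Γ : Ctx} {τ σ : Ty} (e : Expr 𝓜 Γ τ) (d : σ.Den 𝓜) (θ : Env 𝓜 Γ) :
    (e.wk σ).den (Env.cons d θ) = e.den θ := e.den_ren _ _

theorem RTy.den_wk2 {Γ : Ctx} {τ σ : Ty} (T : RTy 𝓜 Γ τ) (d₁ d₂ : σ.Den 𝓜)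
    (θ : Env 𝓜 Γ) : (T.wk2 σ).den (Env.cons2 d₁ d₂ θ) = T.den θ := T.den_ren _ _

theorem RCtx.Valid.cons {Γ : Ctx} {τ : Ty} {G : RCtx 𝓜 Γ} {T : RTy 𝓜 (dbl Γ) τ}
    {θ : Env 𝓜 (dbl Γ)} (hθ : G.Valid θ) {d₁ d₂ : τ.Den 𝓜} (h : T.den θ d₁ d₂) :
    (G.cons T).Valid (Env.cons2 d₁ d₂ θ) :=
  ⟨hθ, h⟩

/-- The variable that carries an assumption has the unit type, hence the value `()` on both
sides. -/
theorem RCtx.Valid.assume {Γ : Ctx} {G : RCtx 𝓜 Γ} {φ : Assn 𝓜 (dbl Γ)}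
    {θ : Env 𝓜 (dbl Γ)} (hθ : G.Valid θ) (h : φ.den θ) :
    (G.assume φ).Valid (Env.cons2 (τ := .base .unit) () () θ) :=
  hθ.cons (by
    simp only [RTy.den, Assn.den_ren, Env.pull_wk2]
    exact ⟨trivial, h⟩)

theorem RCtx.Valid.pushNat {Γ : Ctx} {G : RCtx 𝓜 Γ} {φ : Assn 𝓜 (dbl (.base .nat :: Γ))}
    {θ : Env 𝓜 (dbl Γ)} (hθ : G.Valid θ) (m n : ℕ)
    (h : φ.den (Env.cons2 (τ := .base .nat) m n θ)) :
    (G.pushNat φ).Valid (Env.cons2 (τ := .base .nat) m n θ) :=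
  hθ.cons (by
    simp only [RTy.den]
    exact ⟨trivial, h⟩)

theorem RCtx.Valid.pushList {Γ : Ctx} {b : BTy} {G : RCtx 𝓜 Γ}
    {φ : Assn 𝓜 (dbl (.base (.list b) :: .base b :: Γ))} {θ : Env 𝓜 (dbl Γ)} (hθ : G.Valid θ)
    (a a' : b.den) (l l' : List b.den)
    (h : φ.den (Env.cons2 (τ := .base (.list b)) l l' (Env.cons2 (τ := .base b) a a' θ))) :
    (G.pushList φ).Valid
      (Env.cons2 (τ := .base (.list b)) l l' (Env.cons2 (τ := .base b) a a' θ)) :=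
  RCtx.Valid.cons (hθ.cons (by simp only [RTy.den])) (by
    simp only [RTy.den]
    exact ⟨trivial, h⟩)

theorem RCtx.Valid.lookup {Γ : Ctx} {τ : Ty} (G : RCtx 𝓜 Γ) (x : Var Γ τ)
    {θ : Env 𝓜 (dbl Γ)} (hθ : G.Valid θ) :
    (G.lookup x).den θ (θ.left _ x) (θ.right _ x) := by
  induction G with
  | nil => nomatch x
  | cons G T ih =>
    obtain ⟨hG, hT⟩ := hθ
    cases x with
    | z =>
      rw [RCtx.lookup, RTy.den_ren]
      exact hT
    | s x =>
      rw [RCtx.lookup, RTy.den_ren]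
      exact ih x hG

end PrivInfer

/-! ### Divergences and liftings -/

namespace PrivInfer

theorem atZero_mono {f g : ℝ → ℝ} (h : ∀ x, 0 < x → f x ≤ g x) : atZero f ≤ atZero g := by
  refine limsup_le_limsup ?_
  filter_upwards [self_mem_nhdsWithin] with t ht
  exact EReal.coe_le_coe_iff.2 (h t ht)

theorem slopeAtTop_mono {f g : ℝ → ℝ} (h : ∀ x, 0 < x → f x ≤ g x) :
    slopeAtTop f ≤ slopeAtTop g := by
  refine limsup_le_limsup ?_
  filter_upwards [eventually_gt_atTop 0] with u hu
  exact EReal.coe_le_coe_iff.2 (div_le_div_of_nonneg_right (h u hu) hu.le)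

@[simp] theorem divTerm_zero_zero (f : ℝ → ℝ) : divTerm f 0 0 = 0 := by
  simp [divTerm]

theorem divTerm_mono {f g : ℝ → ℝ} (h : ∀ x, 0 < x → f x ≤ g x) {p q : ℝ≥0∞}
    (hp : p ≠ ∞) (hq : q ≠ ∞) : divTerm f p q ≤ divTerm g p q := by
  unfold divTerm
  split_ifs with hq0 hp0 hp0
  · exact le_rfl
  · exact mul_le_mul_of_nonneg_left (slopeAtTop_mono h) (EReal.coe_ennreal_nonneg p)
  · exact mul_le_mul_of_nonneg_left (atZero_mono h) (EReal.coe_ennreal_nonneg q)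
  · refine mul_le_mul_of_nonneg_left (EReal.coe_le_coe_iff.2 (h _ ?_))
      (EReal.coe_ennreal_nonneg q)
    exact ENNReal.toReal_pos (ENNReal.div_pos hp0 hq).ne' (ENNReal.div_ne_top hp hq0)

theorem fDiv_mono {A : Type} {f g : ℝ → ℝ} (h : ∀ x, 0 < x → f x ≤ g x) (μ ν : PMF A) :
    fDiv f μ ν ≤ fDiv g μ ν := by
  have hd (a : A) : divTerm f (μ a) (ν a) ≤ divTerm g (μ a) (ν a) :=
    divTerm_mono h (μ.apply_ne_top a) (ν.apply_ne_top a)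
  refine EReal.sub_le_sub ?_ ?_
  · exact EReal.coe_ennreal_le_coe_ennreal_iff.2 <|
      ENNReal.tsum_le_tsum fun a => EReal.toENNReal_le_toENNReal (hd a)
  · exact EReal.coe_ennreal_le_coe_ennreal_iff.2 <|
      ENNReal.tsum_le_tsum fun a => EReal.toENNReal_le_toENNReal (EReal.neg_le_neg_iff.2 (hd a))

theorem fDiv_pure_self {A : Type} {f : ℝ → ℝ} (hf : f 1 = 0) (a : A) :
    fDiv f (PMF.pure a) (PMF.pure a) = 0 := by
  have h (x : A) : divTerm f (PMF.pure a x) (PMF.pure a x) = 0 := by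
    by_cases hx : x = a <;> simp [divTerm, PMF.pure_apply, hx, hf]
  simp only [fDiv, h]
  simp

/-- Distributions on the diagonal have the divergence of their projections: the summands off the
diagonal are `0 * f (0 / 0) = 0`. -/
theorem fDiv_of_diag {A : Type} (f : ℝ → ℝ) {μ ν : PMF (A × A)}
    (hμ : ∀ a b, 0 < μ (a, b) → a = b) (hν : ∀ a b, 0 < ν (a, b) → a = b) :
    fDiv f (μ.map Prod.fst) (ν.map Prod.snd) = fDiv f μ ν := by
  have hz {κ : PMF (A × A)} (hκ : ∀ a b, 0 < κ (a, b) → a = b) (x : A × A)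
      (hx : x ∉ Set.range fun a : A => (a, a)) : κ x = 0 := by
    by_contra h0
    refine hx ⟨x.1, ?_⟩
    have h1 : x.1 = x.2 := hκ x.1 x.2 (pos_iff_ne_zero.2 h0)
    exact Prod.ext rfl h1
  have hinj : Function.Injective fun a : A => (a, a) := fun a b h => congrArg Prod.fst h
  have hfst (a : A) : μ.map Prod.fst a = μ (a, a) := by
    rw [PMF.map_apply, tsum_eq_single (a, a)]
    · simp
    · rintro ⟨x, y⟩ hne
      split_ifs with h
      · by_contra h0
        have h1 : x = y := hμ x y (pos_iff_ne_zero.2 h0)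
        exact hne (by rw [← h1, h])
      · rfl
  have hsnd (a : A) : ν.map Prod.snd a = ν (a, a) := by
    rw [PMF.map_apply, tsum_eq_single (a, a)]
    · simp
    · rintro ⟨x, y⟩ hne
      split_ifs with h
      · by_contra h0
        have h1 : x = y := hν x y (pos_iff_ne_zero.2 h0)
        exact hne (by rw [h1, h])
      · rfl
  have hsum (F : EReal → ℝ≥0∞) (hF : F 0 = 0) :
      ∑' a, F (divTerm f (μ (a, a)) (ν (a, a))) = ∑' x, F (divTerm f (μ x) (ν x)) := by
    refine hinj.tsum_eq (f := fun x => F (divTerm f (μ x) (ν x))) fun x hx => ?_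
    by_contra h
    refine hx ?_
    simp only [hz hμ x h, hz hν x h, divTerm_zero_zero, hF]
  simp only [fDiv, hfst, hsnd]
  rw [hsum EReal.toENNReal (by simp), hsum (fun x => (-x).toENNReal) (by simp)]

/-- A lifting of equality is a bound on the divergence. -/
theorem lifting_eq_iff {A : Type} {f : ℝ → ℝ} {δ : ℝ≥0∞} {Ψ : A → A → Prop}
    (hΨ : ∀ a b, Ψ a b ↔ a = b) {μ ν : PMF A} :
    Lifting f δ Ψ μ ν ↔ fDiv f μ ν ≤ (δ : EReal) := by
  constructor
  · rintro ⟨μL, μR, hL, hR, rfl, rfl, h⟩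
    rwa [fDiv_of_diag f (fun a b hab => (hΨ a b).1 (hL a b hab))
      (fun a b hab => (hΨ a b).1 (hR a b hab))]
  · intro h
    have hd (κ : PMF A) (a b : A) (hab : 0 < κ.map (fun a => (a, a)) (a, b)) : a = b := by
      obtain ⟨c, -, hc⟩ := (PMF.mem_support_map_iff _ _ _).1
        ((PMF.mem_support_iff _ _).2 hab.ne')
      exact (congrArg Prod.fst hc).symm.trans (congrArg Prod.snd hc)
    have h1 (κ : PMF A) : (κ.map fun a => (a, a)).map Prod.fst = κ := by
      rw [PMF.map_comp]; exact PMF.map_id κ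
    have h2 (κ : PMF A) : (κ.map fun a => (a, a)).map Prod.snd = κ := by
      rw [PMF.map_comp]; exact PMF.map_id κ
    refine ⟨μ.map fun a => (a, a), ν.map fun a => (a, a), fun a b hab => (hΨ a b).2 (hd μ a b hab),
      fun a b hab => (hΨ a b).2 (hd ν a b hab), h1 μ, h2 ν, ?_⟩
    rwa [← fDiv_of_diag f (hd μ) (hd ν), h1, h2]

theorem Lifting.pure {A B : Type} {f : ℝ → ℝ} (hf : ClassF f) (δ : ℝ≥0∞) {Ψ : A → B → Prop}
    {a : A} {b : B} (h : Ψ a b) : Lifting f δ Ψ (PMF.pure a) (PMF.pure b) := by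
  have hs (x : A) (y : B) (hxy : 0 < PMF.pure (a, b) (x, y)) : Ψ x y := by
    have := (PMF.mem_support_pure_iff _ _).1 ((PMF.mem_support_iff _ _).2 hxy.ne')
    obtain ⟨rfl, rfl⟩ := Prod.ext_iff.1 this
    exact h
  refine ⟨PMF.pure (a, b), PMF.pure (a, b), hs, hs, PMF.pure_map _ _, PMF.pure_map _ _, ?_⟩
  rw [fDiv_pure_self hf.2]
  exact EReal.coe_ennreal_nonneg δ

/-- A lifted relation is inhabited, because distributions have nonempty support. -/
theorem Lifting.exists_rel {A B : Type} {f : ℝ → ℝ} {δ : ℝ≥0∞} {Ψ : A → B → Prop} {μ : PMF A}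
    {ν : PMF B} (h : Lifting f δ Ψ μ ν) : ∃ a b, Ψ a b := by
  obtain ⟨μL, -, hL, -⟩ := h
  obtain ⟨⟨a, b⟩, hab⟩ := μL.support_nonempty
  exact ⟨a, b, hL a b (pos_iff_ne_zero.2 ((PMF.mem_support_iff _ _).1 hab))⟩

theorem Lifting.mono {A B : Type} {f g : ℝ → ℝ} {δ ε : ℝ≥0∞} {Ψ Φ : A → B → Prop} {μ : PMF A}
    {ν : PMF B} (h : Lifting f δ Ψ μ ν) (hfg : ∀ x, 0 < x → g x ≤ f x) (hδ : δ ≤ ε)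
    (hΨ : ∀ a b, Ψ a b → Φ a b) : Lifting g ε Φ μ ν := by
  obtain ⟨μL, μR, hL, hR, h1, h2, hd⟩ := h
  exact ⟨μL, μR, fun a b hab => hΨ a b (hL a b hab), fun a b hab => hΨ a b (hR a b hab), h1, h2,
    (fDiv_mono hfg μL μR).trans (hd.trans (EReal.coe_ennreal_le_coe_ennreal_iff.2 hδ))⟩

/-- Liftings compose along `PMF.bind`. -/
theorem Lifting.bind {A B C D : Type} [Nonempty C] [Nonempty D] {f₁ f₂ f₃ : ℝ → ℝ}
    (hf : Composable f₁ f₂ f₃) {δ₁ δ₂ : ℝ≥0∞} {Ψ : A → B → Prop} {Φ : C → D → Prop}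
    {μ : PMF A} {ν : PMF B} {M : A → PMF C} {N : B → PMF D} (h : Lifting f₁ δ₁ Ψ μ ν)
    (hM : ∀ a b, Ψ a b → Lifting f₂ δ₂ Φ (M a) (N b)) :
    Lifting f₃ (δ₁ + δ₂) Φ (μ.bind M) (ν.bind N) := by
  obtain ⟨-, hf₂, -, hcomp⟩ := hf
  obtain ⟨μL, μR, hL, hR, rfl, rfl, hd⟩ := h
  -- At unrelated pairs, which have probability `0`, both couplings are the same Dirac measure,
  -- so that these pairs do not raise the supremum of the divergences above `δ₂`.
  have hex (x : A × B) : ∃ κ : PMF (C × D) × PMF (C × D), fDiv f₂ κ.1 κ.2 ≤ (δ₂ : EReal) ∧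
      (Ψ x.1 x.2 → (∀ c d, 0 < κ.1 (c, d) → Φ c d) ∧ (∀ c d, 0 < κ.2 (c, d) → Φ c d) ∧
        κ.1.map Prod.fst = M x.1 ∧ κ.2.map Prod.snd = N x.2) := by
    by_cases hx : Ψ x.1 x.2
    · obtain ⟨κL, κR, h1, h2, h3, h4, h5⟩ := hM _ _ hx
      exact ⟨(κL, κR), h5, fun _ => ⟨h1, h2, h3, h4⟩⟩
    · obtain ⟨y⟩ : Nonempty (C × D) := inferInstance
      refine ⟨(PMF.pure y, PMF.pure y), ?_, fun h => absurd h hx⟩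
      rw [fDiv_pure_self hf₂.2]
      exact EReal.coe_ennreal_nonneg δ₂
  choose κ hκ hκΨ using hex
  have hsupp {ξ : PMF (A × B)} (hξ : ∀ a b, 0 < ξ (a, b) → Ψ a b) (x : A × B)
      (hx : x ∈ ξ.support) : Ψ x.1 x.2 :=
    hξ x.1 x.2 (pos_iff_ne_zero.2 ((PMF.mem_support_iff _ _).1 hx))
  have hcongr {E F : Type} (ξ : PMF F) (K K' : F → PMF E) (h : ∀ x ∈ ξ.support, K x = K' x) :
      ξ.bind K = ξ.bind K' := by
    ext e
    rw [PMF.bind_apply, PMF.bind_apply]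
    refine tsum_congr fun x => ?_
    by_cases hx : ξ x = 0
    · simp [hx]
    · rw [h x ((PMF.mem_support_iff _ _).2 hx)]
  refine ⟨μL.bind fun x => (κ x).1, μR.bind fun x => (κ x).2, fun c d hcd => ?_,
    fun c d hcd => ?_, ?_, ?_, ?_⟩
  · obtain ⟨x, hx, hx'⟩ := (PMF.mem_support_bind_iff _ _ _).1
      ((PMF.mem_support_iff _ _).2 hcd.ne')
    exact (hκΨ x (hsupp hL x hx)).1 c d (pos_iff_ne_zero.2 ((PMF.mem_support_iff _ _).1 hx'))
  · obtain ⟨x, hx, hx'⟩ := (PMF.mem_support_bind_iff _ _ _).1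
      ((PMF.mem_support_iff _ _).2 hcd.ne')
    exact (hκΨ x (hsupp hR x hx)).2.1 c d (pos_iff_ne_zero.2 ((PMF.mem_support_iff _ _).1 hx'))
  · rw [PMF.map_bind, PMF.bind_map]
    exact hcongr _ _ _ fun x hx => (hκΨ x (hsupp hL x hx)).2.2.1
  · rw [PMF.map_bind, PMF.bind_map]
    exact hcongr _ _ _ fun x hx => (hκΨ x (hsupp hR x hx)).2.2.2
  · refine (hcomp (A × B) (C × D) μL μR _ _).trans ?_
    rw [EReal.coe_ennreal_add]
    exact add_le_add hd (iSup_le hκ)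

end PrivInfer

/-! ### Soundness of subtyping and typing -/

namespace PrivInfer

variable {𝓜 : Model}

theorem Subtyping.sound {Γ : Ctx} {τ : Ty} {G : RCtx 𝓜 Γ} {T U : RTy 𝓜 (dbl Γ) τ}
    (h : Subtyping G T U) {θ : Env 𝓜 (dbl Γ)} (hθ : G.Valid θ) {d₁ d₂ : τ.Den 𝓜}
    (hd : T.den θ d₁ d₂) : U.den θ d₁ d₂ := by
  induction h with
  | refl => exact hd
  | trans _ _ ih₁ ih₂ => exact ih₂ hθ (ih₁ hθ hd)
  | left =>
    rw [RTy.den] at hd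
    exact hd.1
  | right _ hφ ih =>
    rw [RTy.den]
    exact ⟨ih hθ hd, hφ _ (hθ.cons hd)⟩
  | pi _ _ ihT ihU =>
    rw [RTy.den] at hd ⊢
    intro x₁ x₂ hx
    exact ihU (hθ.cons hx) (hd _ _ (ihT hθ hx))
  | mon _ _ _ hle ih =>
    rw [RTy.den] at hd ⊢
    -- The side condition is stated under a related pair of values, and such a pair exists.
    obtain ⟨a, b, hab⟩ := Lifting.exists_rel hd
    obtain ⟨hf, hδ, -⟩ := hle _ (hθ.cons hab)
    simp only [Expr.denF_ren, Expr.denE_ren, Env.pull_wk2] at hf hδ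
    exact Lifting.mono hd hf hδ fun x y hxy => ih hθ hxy

/-- A recursive equation with a unique solution is solved by `recVal`; the default value is not
reached. -/
theorem isRec_recVal {A B : Type} {F : (A → B) → A → B} (h : ∃! g, IsRec F g) (d : A → B) :
    IsRec F (recVal F d) := by
  rw [recVal, dif_pos h]
  exact h.choose_spec.1

theorem RTy.den_diag_iff {Γ : Ctx} {v : VTy} {θ : Env 𝓜 Γ} (a b : v.Den 𝓜) :
    (RTy.diag v).den θ a b ↔ a = b := by
  simp only [RTy.den, true_and]
  rfl

theorem RTy.den_mon_diag_iff {Γ : Ctx} {v : VTy} {f : Expr 𝓜 Γ FTy}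
    {δ : Expr 𝓜 Γ (.base .ereal)} {θ : Env 𝓜 Γ} {μ ν : PMF (v.Den 𝓜)} :
    (RTy.mon f δ (.diag v)).den θ μ ν ↔ fDiv (f.denF θ) μ ν ≤ (δ.denE θ : EReal) := by
  rw [RTy.den]
  exact lifting_eq_iff RTy.den_diag_iff

theorem RTy.den_ref_divDist_iff {Γ : Ctx} {b : BTy} {f : Expr 𝓜 Γ FTy}
    {δ : Expr 𝓜 Γ (.base .ereal)} {θ : Env 𝓜 Γ} {d₁ d₂ : SymDist 𝓜.Sym b} :
    (RTy.ref (.val (.dist b)) (.divDist (f.wk2 _) (.var .z) (.var (.s .z)) (δ.wk2 _))).den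
      θ d₁ d₂ ↔ fDiv (f.denF θ) (law 𝓜 d₁) (law 𝓜 d₂) ≤ (δ.denE θ : EReal) := by
  simp only [RTy.den, Assn.den, true_and, Expr.denF_ren, Expr.denE_ren, Env.pull_wk2]
  rfl

instance (v : VTy) : Nonempty (v.Den 𝓜) := ⟨v.inhabitant 𝓜⟩

/-- The two sides of a derivable judgement denote a related pair of values. -/
theorem Typing.sound {Γ : Ctx} {τ : Ty} {G : RCtx 𝓜 Γ} {e e' : Expr 𝓜 Γ τ}
    {T : RTy 𝓜 (dbl Γ) τ} (h : Typing G e e' T) {θ : Env 𝓜 (dbl Γ)} (hθ : G.Valid θ) :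
    T.den θ (e.den θ.left) (e'.den θ.right) := by
  induction h with
  | var G x => exact hθ.lookup G x
  | const h => exact h θ hθ
  | lam _ ih =>
    rw [RTy.den]
    intro d₁ d₂ hd
    have := ih (hθ.cons hd)
    rwa [Env.left_cons2, Env.right_cons2] at this
  | app _ _ ihf iha =>
    have hf := ihf hθ
    rw [RTy.den] at hf
    rw [RTy.den_subst, Env.pullSub_inst2, Expr.den_L, Expr.den_R]
    exact hf _ _ (iha hθ)
  | @letrec Γ τ σ G T U e e' ψ hdef hwf _ ih =>
    obtain ⟨hrec, hrec'⟩ := hdef θ hθ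
    have hg := isRec_recVal hrec ((τ ⇒ σ).inhabitant 𝓜)
    have hg' := isRec_recVal hrec' ((τ ⇒ σ).inhabitant 𝓜)
    rw [RTy.den]
    intro d₁ d₂
    refine (hwf θ hθ).induction
      (C := fun x => T.den θ x.1 x.2 →
        U.den (Env.cons2 x.1 x.2 θ) (Expr.den (.letrec e) θ.left x.1)
          (Expr.den (.letrec e') θ.right x.2)) (d₁, d₂) ?_
    rintro ⟨x₁, x₂⟩ IH hx
    -- By the induction hypothesis, the two recursive functions are related at the arguments that
    -- precede `(x₁, x₂)`, which is what the type of the recursive variable demands.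
    have hF : (recTy T ψ U).den (Env.cons2 x₁ x₂ θ) (Expr.den (.letrec e) θ.left)
        (Expr.den (.letrec e') θ.right) := by
      rw [RTy.den]
      intro y₁ y₂ hy
      rw [RTy.den, RTy.den_wk2] at hy
      rw [RTy.den_ren, Env.pull_lift2, Env.pull_wk2]
      exact IH (y₁, y₂) hy.2 hy.1
    have := ih ((hθ.cons hx).cons hF)
    rw [RTy.den_wk2] at this
    rw [Env.left_cons2_cons2, Env.right_cons2_cons2] at this
    rw [Expr.den, Expr.den, hg x₁, hg' x₂]
    exact this
  | sub _ hs ih => exact hs.sound hθ (ih hθ)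
  | refine _ hφ ih =>
    have := hφ θ hθ
    rw [Assn.den_subst, Env.pullSub_inst2, Expr.den_L, Expr.den_R] at this
    rw [RTy.den]
    exact ⟨ih hθ, this⟩
  | conv _ h₁ h₂ ih =>
    have h₁ := h₁ θ hθ
    have h₂ := h₂ θ hθ
    simp only [Assn.den, Expr.den_L, Expr.den_R] at h₁ h₂
    rw [h₁, h₂]
    exact ih hθ
  | caseUnit _ _ _ ih => exact ih hθ
  | @caseBool Γ τ G T S s s' et et' ef ef' _ heq _ _ _ iht ihf =>
    have heq : s.den θ.left = s'.den θ.right := by simpa [Assn.den] using heq θ hθ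
    simp only [Expr.den]
    cases hs : s.den θ.left with
    | true =>
      have hs' := heq.symm.trans hs
      rw [hs']
      simpa [RTy.den_wk2, boolCase] using iht (hθ.assume
        (by simpa [Assn.den, Expr.den, Konst.den] using ⟨hs, hs'⟩))
    | false =>
      have hs' := heq.symm.trans hs
      rw [hs']
      simpa [RTy.den_wk2, boolCase] using ihf (hθ.assume
        (by simpa [Assn.den, Expr.den, Konst.den] using ⟨hs, hs'⟩))
  | @caseBoolL Γ τ G T s et ef e' _ _ iht ihf =>
    simp only [Expr.den]
    cases hs : s.den θ.left with
    | true =>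
      simpa [RTy.den_wk2, boolCase] using iht (hθ.assume
        (by simpa [Assn.den, Expr.den, Konst.den] using hs))
    | false =>
      simpa [RTy.den_wk2, boolCase] using ihf (hθ.assume
        (by simpa [Assn.den, Expr.den, Konst.den] using hs))
  | @caseBoolR Γ τ G T s' e et' ef' _ _ iht ihf =>
    simp only [Expr.den]
    cases hs : s'.den θ.right with
    | true =>
      simpa [RTy.den_wk2, boolCase] using iht (hθ.assume
        (by simpa [Assn.den, Expr.den, Konst.den] using hs))
    | false =>
      simpa [RTy.den_wk2, boolCase] using ihf (hθ.assume
        (by simpa [Assn.den, Expr.den, Konst.den] using hs))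
  | @caseNat Γ τ G T S s s' e₀ e₀' e₁ e₁' _ heq _ _ _ ih₀ ih₁ =>
    have heq : s.den θ.left = (0 : ℕ) ↔ s'.den θ.right = (0 : ℕ) := by
      simpa [Assn.den, Expr.den, Konst.den, iff_iff_implies_and_implies] using heq θ hθ
    simp only [Expr.den]
    cases hs : s.den θ.left with
    | zero =>
      have hs' := heq.1 hs
      rw [hs']
      simpa [RTy.den_wk2, natCase] using ih₀ (hθ.assume
        (by simpa [Assn.den, Expr.den, Konst.den] using ⟨hs, hs'⟩))
    | succ m =>
      cases hs' : s'.den θ.right with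
      | zero => exact absurd ((heq.2 hs').symm.trans hs) (Nat.succ_ne_zero m).symm
      | succ n =>
        have := ih₁ (hθ.pushNat m n
          (by simpa [Assn.den, Expr.den, Konst.den, Env.cons] using ⟨hs, hs'⟩))
        rwa [RTy.den_wk2, Env.left_cons2, Env.right_cons2] at this
  | @caseNatL Γ τ G T s e₀ e' e₁ _ _ ih₀ ih₁ =>
    simp only [Expr.den]
    cases hs : s.den θ.left with
    | zero =>
      simpa [RTy.den_wk2, natCase] using ih₀ (hθ.assume
        (by simpa [Assn.den, Expr.den, Konst.den] using hs))
    | succ n =>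
      -- The branch on the other side does not depend on the second instance of `n`.
      have := ih₁ (hθ.pushNat n n
        (by simpa [Assn.den, Expr.den, Konst.den, Env.cons] using hs))
      rwa [RTy.den_wk2, Env.left_cons2, Env.right_cons2, Expr.den_wk] at this
  | @caseNatR Γ τ G T s' e e₀' e₁' _ _ ih₀ ih₁ =>
    simp only [Expr.den]
    cases hs : s'.den θ.right with
    | zero =>
      simpa [RTy.den_wk2, natCase] using ih₀ (hθ.assume
        (by simpa [Assn.den, Expr.den, Konst.den] using hs))
    | succ n =>
      -- The branch on the other side does not depend on the second instance of `n`.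
      have := ih₁ (hθ.pushNat n n
        (by simpa [Assn.den, Expr.den, Konst.den, Env.cons] using hs))
      rwa [RTy.den_wk2, Env.left_cons2, Env.right_cons2, Expr.den_wk] at this
  | @caseList Γ τ b G T S s s' e₀ e₀' e₁ e₁' _ heq _ _ _ ih₀ ih₁ =>
    have heq : s.den θ.left = ([] : List b.den) ↔ s'.den θ.right = ([] : List b.den) := by
      simpa [Assn.den, Expr.den, Konst.den, iff_iff_implies_and_implies] using heq θ hθ
    simp only [Expr.den]
    cases hs : s.den θ.left with
    | nil =>
      have hs' := heq.1 hs
      rw [hs']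
      simpa [RTy.den_wk2, listCase] using ih₀ (hθ.assume
        (by simpa [Assn.den, Expr.den, Konst.den] using ⟨hs, hs'⟩))
    | cons a l =>
      cases hs' : s'.den θ.right with
      | nil => exact absurd ((heq.2 hs').symm.trans hs) (List.cons_ne_nil a l).symm
      | cons a' l' =>
        have := ih₁ (hθ.pushList a a' l l'
          (by simpa [Assn.den, Expr.den, Konst.den, Env.cons] using ⟨hs, hs'⟩))
        rwa [RTy.den_wk2, RTy.den_wk2, Env.left_cons2_cons2, Env.right_cons2_cons2] at this
  | @caseListL Γ τ b G T s e₀ e' e₁ _ _ ih₀ ih₁ =>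
    simp only [Expr.den]
    cases hs : s.den θ.left with
    | nil =>
      simpa [RTy.den_wk2, listCase] using ih₀ (hθ.assume
        (by simpa [Assn.den, Expr.den, Konst.den] using hs))
    | cons a l =>
      -- As for `caseNatL` and `caseNatR`, the instances on the other side are irrelevant.
      have := ih₁ (hθ.pushList a a l l
        (by simpa [Assn.den, Expr.den, Konst.den, Env.cons] using hs))
      rwa [RTy.den_wk2, RTy.den_wk2, Env.left_cons2_cons2, Env.right_cons2_cons2, Expr.den_wk,
        Expr.den_wk] at this
  | @caseListR Γ τ b G T s' e e₀' e₁' _ _ ih₀ ih₁ =>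
    simp only [Expr.den]
    cases hs : s'.den θ.right with
    | nil =>
      simpa [RTy.den_wk2, listCase] using ih₀ (hθ.assume
        (by simpa [Assn.den, Expr.den, Konst.den] using hs))
    | cons a l =>
      -- As for `caseNatL` and `caseNatR`, the instances on the other side are irrelevant.
      have := ih₁ (hθ.pushList a a l l
        (by simpa [Assn.den, Expr.den, Konst.den, Env.cons] using hs))
      rwa [RTy.den_wk2, RTy.den_wk2, Env.left_cons2_cons2, Env.right_cons2_cons2, Expr.den_wk,
        Expr.den_wk] at this
  | unitM hf _ ih =>
    rw [RTy.den]
    exact Lifting.pure (hf θ hθ) _ (ih hθ)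
  | bindM _ hf hδ _ ih₁ ih₂ =>
    have h₁ := ih₁ hθ
    rw [RTy.den] at h₁ ⊢
    rw [hδ θ hθ]
    refine Lifting.bind (hf θ hθ) h₁ fun a b hab => ?_
    have h₂ := ih₂ (hθ.cons hab)
    rw [RTy.den] at h₂
    simpa [RTy.den_ren] using h₂
  | @infer Γ b G e e' f δ _ ih =>
    rw [RTy.den_ref_divDist_iff]
    have := RTy.den_mon_diag_iff.1 (ih hθ)
    simp only [Expr.den, law, 𝓜.algInf_exact]
    exact this
  | ran _ ih => exact RTy.den_mon_diag_iff.2 (RTy.den_ref_divDist_iff.1 (ih hθ))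
  | observe _ _ h _ _ =>
    have h := h θ hθ
    simp only [Assn.den, Expr.denM_ren] at h
    exact RTy.den_mon_diag_iff.2 h

end PrivInfer

theorem mainTheorem3 (𝓜 : PrivInfer.Model) {Γ : PrivInfer.Ctx} (G : PrivInfer.RCtx 𝓜 Γ)
    (v : PrivInfer.VTy) (e₁ e₂ : PrivInfer.Expr 𝓜 Γ (.mon v))
    (f : PrivInfer.Expr 𝓜 (PrivInfer.dbl Γ) PrivInfer.FTy)
    (δ : PrivInfer.Expr 𝓜 (PrivInfer.dbl Γ) (.base .ereal))
    (h : PrivInfer.Typing G e₁ e₂ (.mon f δ (.ref (.val v) (.eq (.var .z) (.var (.s .z))))))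
    (θ : PrivInfer.Env 𝓜 (PrivInfer.dbl Γ)) (hθ : G.Valid θ) :
    PrivInfer.fDiv (f.denF θ) (e₁.denM θ.left) (e₂.denM θ.right) ≤ (δ.denE θ : EReal) :=
  PrivInfer.RTy.den_mon_diag_iff.1 (h.sound hθ)
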